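/- Let $(V,c)$ be a finite metric space, $s,t\in V$ with $s\neq t$, and $E=\binom V2$. For $U\subseteq V$ let $\delta(U)$ be the set of edges with exactly one endpoint in $U$ and $E[U]$ the set of edges with both endpoints in $U$; for $x\in\mathbb R^E$ and $F\subseteq E$ let $x(F)=\sum_{e\in F}x_e$, $c(x)=\sum_{e}c(e)x_e$, $c(F)=\sum_{e\in F}c(e)$, and let $\chi^e$ be the incidence vector of $e$. An $s$-$t$-tour is the edge set of a path with endpoints $s$ and $t$ that visits every vertex of $V$; OPT is the minimum cost of an $s$-$t$-tour. Let $0<\varepsilon\le\frac12$, $k=\lceil\log_2(1/\varepsilon)\rceil$ and $\lambda_l=\frac{2^{k-l+1}-1}{2^{k+1}-3}$ for $l=1,\dots,k$. Consider the following recursive dynamic program. Its input consists of disjoint sets $W_s,W_t\subseteq V$, vertices $s',t'\in W:=V\setminus(W_s\cup W_t)$ (possibly $s'=t'$), a set $\mathcal B$ of cuts $\delta(U)$ with $W_s\cup\{s'\}\subseteq U\subseteq V\setminus(W_t\cup\{t'\})$, and a level $l\in\{1,\dots,k\}$. First it computes a vector $x^*\in\mathbb R^E$ that minimizes $c(x)$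 subject to $x(\delta(U))\ge2$ for $\emptyset\ne U\subseteq W\setminus\{s',t'\}$; $x(\delta(U))\ge1$ for $\{s'\}\subseteq U\subseteq W\setminus\{t'\}$; $x(C)\ge3$ for $C\in\mathcal B$; $x_e\ge0$ for $e\in E[W]$; and $x_e=0$ for $e\in E\setminus E[W]$. If $l=k$, it returns $y:=x^*$, a minimum-cost tree $(W,S)$, and the empty set of cuts $\mathcal L=\emptyset$. If $l<k$, let $\mathcal N=\{\delta(U): W_s\cup\{s'\}\subseteq U\subseteq V\setminus(W_t\cup\{t'\}),\ x^*(\delta(U))<2\}$, and let $D$ be the digraph whose vertices are the triples $(U,v,w)$ with $\delta(U)\in\mathcal N$, $s'\in U$, $v\in U\cap W$, $w\in W\setminus U$, together with $(W_s,\emptyset,s')$ and $(V\setminus W_t,t',\emptyset)$, and whose arcs are the pairs $a=((U_1,v_1,w_1),(U_2,v_2,w_2))$ with $U_1\subsetneq U_2$ and $w_1,v_2\in U_2\setminus U_1$. For every arc $a$ the program is called recursively on level $l+1$ with $W_s=U_1$, $W_t=V\setminus U_2$, $s'=w_1$, $t'=v_2$ and $\mathcal B=\{\delta(U)\in\mathcal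 N\cup\mathcal B: U_1\cup\{w_1\}\subseteq U\subseteq U_2\setminus\{v_2\}\}$; let $S^a,y^a,\mathcal L^a$ be what it returns, and let $d(a)=c(S^a)+\lambda_{l+1}c(y^a)$, plus $(1+\lambda_{l+1})c(v_2,w_2)$ if $w_2\neq\emptyset$. Let $P$ be a shortest path in $D$ with respect to $d$ from $(W_s,\emptyset,s')$ to $(V\setminus W_t,t',\emptyset)$, let $(V_1,v_1,w_1),\dots,(V_m,v_m,w_m)$ be its inner vertices in order, and let $f_j=\{v_j,w_j\}$. The program returns $$S=\bigcup_{a\in E(P)}S^a\cup\{f_1,\dots,f_m\},\qquad y=\frac{\lambda_l-\lambda_{l+1}}{\lambda_l}\,x^*+\frac{\lambda_{l+1}}{\lambda_l}\,y',\qquad y'=\sum_{a\in E(P)}y^a+\sum_{j=1}^m\chi^{f_j},$$ and $\mathcal L=\bigcup_{a\in E(P)}\mathcal L^a\cup\{\delta(V_1),\dots,\delta(V_m)\}$. All optimum LP solutions, minimum-cost trees and shortest paths may be chosen arbitrarily. Then $\lambda_1=\frac{2^k-1}{2^{k+1}-3}\le\frac12+\varepsilon$. The call with $W_s=W_t=\emptyset$,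 $s'=s$, $t'=t$, $\mathcal B=\emptyset$, $l=1$ has an output, OPT is attained, and for every possible output $(S^*,y^*,\mathcal L^*)$ of this call: (i) $(V,S^*)$ is a spanning tree; (ii) with $T=\{v\in V:|S^*\cap\delta(v)|\text{ odd}\}\,\triangle\,\{s\}\,\triangle\,\{t\}$, the vector $\lambda_1 y^*$ lies in the $T$-join polyhedron $$\{x\in\mathbb R^E_{\ge0}: x(\delta(U))\ge1\text{ for all }\emptyset\ne U\subsetneq V\text{ with }|U\cap T|\text{ odd}\};$$ (iii) $c(S^*)+\lambda_1 c(y^*)\le\left(\frac32+\varepsilon\right)\mathrm{OPT}$. -/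

import Mathlib

open scoped Finset

/-! The recursive dynamic program for the `s`-`t`-path TSP on a finite metric space `V`.

Edges of the complete graph `(V, E)` are the non-loop elements of `Sym2 V`.  A vector in `ℝ^E` is
a function `Sym2 V → ℝ` that vanishes on the loops. -/

namespace PathTSP

variable {V : Type*} [Fintype V] [DecidableEq V]

/-- `δ(U)`: the edges with exactly one endpoint in `U`. -/
def cut (U : Finset V) : Finset (Sym2 V) :=
  Finset.univ.filter fun e => ∃ u ∈ U, ∃ v, v ∉ U ∧ e = s(u, v)

/-- `E[U]`: the edges of the complete graph with both endpoints in `U`. -/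
def edgesIn (U : Finset V) : Finset (Sym2 V) :=
  U.sym2.filter fun e => ¬ e.IsDiag

/-- `x(F)`: the sum of the entries of `x` over the edge set `F`. -/
def weight (x : Sym2 V → ℝ) (F : Finset (Sym2 V)) : ℝ :=
  ∑ e ∈ F, x e

/-- The incidence vector of the edge set `F`. -/
def incidence (F : Finset (Sym2 V)) : Sym2 V → ℝ :=
  fun e => if e ∈ F then 1 else 0

section Cost

variable [MetricSpace V]

/-- The cost of an edge: the distance of its endpoints. -/
noncomputable def edgeCost : Sym2 V → ℝ :=
  Sym2.lift ⟨fun v w => dist v w, fun v w => dist_comm v w⟩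

/-- `c(x)` for a vector `x`. -/
noncomputable def vecCost (x : Sym2 V → ℝ) : ℝ :=
  ∑ e ∈ edgesIn (Finset.univ : Finset V), edgeCost e * x e

/-- `c(F)` for an edge set `F`. -/
noncomputable def setCost (F : Finset (Sym2 V)) : ℝ :=
  ∑ e ∈ F, edgeCost e

end Cost

/-- `(W, S)` is a tree. -/
def IsTreeOn (W : Finset V) (S : Finset (Sym2 V)) : Prop :=
  S ⊆ edgesIn W ∧
    ((SimpleGraph.fromEdgeSet (S : Set (Sym2 V))).induce (W : Set V)).IsTree

/-- `(W, S)` is a tree of minimum cost. -/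
def IsMinTreeOn [MetricSpace V] (W : Finset V) (S : Finset (Sym2 V)) : Prop :=
  IsTreeOn W S ∧ ∀ S', IsTreeOn W S' → setCost S ≤ setCost S'

/-- `H` is the edge set of a path with endpoints `s` and `t` that spans all vertices. -/
def IsTour (s t : V) (H : Finset (Sym2 V)) : Prop :=
  ∃ p : (⊤ : SimpleGraph V).Walk s t, p.IsHamiltonian ∧ p.edges.toFinset = H

/-- The vertices of wrong parity: `{v : |δ(v) ∩ S| odd} △ {s} △ {t}`. -/
def wrongParity (S : Finset (Sym2 V)) (s t : V) : Finset V :=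
  symmDiff (symmDiff (Finset.univ.filter fun v => Odd #(cut {v} ∩ S)) {s}) {t}

/-- The `T`-join polyhedron in `ℝ^E`. -/
def tJoinPolyhedron (T : Finset V) : Set (Sym2 V → ℝ) :=
  {x | (∀ e, 0 ≤ x e) ∧ (∀ e, e.IsDiag → x e = 0) ∧
    ∀ U : Finset V, U.Nonempty → U ≠ Finset.univ → Odd #(U ∩ T) → 1 ≤ weight x (cut U)}

/-- The coefficient `λ_l = (2^(k-l+1) - 1) / (2^(k+1) - 3)`, for levels `1 ≤ l ≤ k`. -/
noncomputable def coeff (k l : ℕ) : ℝ :=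
  ((2 : ℝ) ^ (k - l + 1) - 1) / ((2 : ℝ) ^ (k + 1) - 3)

/-- An input to the dynamic program (apart from the level): sets `W_s`, `W_t`, vertices `s'`, `t'`
and the collection `B` of busy cuts (as edge sets). -/
structure Input (V : Type*) where
  Ws : Finset V
  Wt : Finset V
  s : V
  t : V
  B : Set (Finset (Sym2 V))

/-- What the dynamic program returns: the edge set of a tree, a vector and a set of cuts. -/
structure Output (V : Type*) where
  S : Finset (Sym2 V)
  y : Sym2 V → ℝ
  L : Set (Finset (Sym2 V))

/-- A triple `(U, v, w)`, where `v` and `w` may be absent (`∅`, here `none`). -/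
structure Node (V : Type*) where
  U : Finset V
  v : Option V
  w : Option V

/-- `{{v, w}}` for the triple `(U, v, w)` if both `v` and `w` are present, else the empty set. -/
def Node.link (a : Node V) : Finset (Sym2 V) :=
  match a.v, a.w with
  | some v, some w => {s(v, w)}
  | _, _ => ∅

namespace Input

/-- `W = V \ (W_s ∪ W_t)`. -/
def W (I : Input V) : Finset V := Finset.univ \ (I.Ws ∪ I.Wt)

/-- Feasible solutions of the linear program of the input. -/
structure IsFeasible (I : Input V) (x : Sym2 V → ℝ) : Prop where
  two_le : ∀ U : Finset V, U.Nonempty → U ⊆ I.W \ {I.s, I.t} → 2 ≤ weight x (cut U)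
  one_le : ∀ U : Finset V, {I.s} ⊆ U → U ⊆ I.W \ {I.t} → 1 ≤ weight x (cut U)
  busy : ∀ C ∈ I.B, 3 ≤ weight x C
  nonneg : ∀ e ∈ edgesIn I.W, 0 ≤ x e
  support : ∀ e, e ∉ edgesIn I.W → x e = 0

/-- Optimum solutions of the linear program of the input. -/
def IsOptimal [MetricSpace V] (I : Input V) (x : Sym2 V → ℝ) : Prop :=
  I.IsFeasible x ∧ ∀ z, I.IsFeasible z → vecCost x ≤ vecCost z

/-- The set `N` of narrow cuts of the vector `x`. -/
def narrow (I : Input V) (x : Sym2 V → ℝ) : Set (Finset (Sym2 V)) :=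
  {C | ∃ U : Finset V, I.Ws ∪ {I.s} ⊆ U ∧ U ⊆ Finset.univ \ (I.Wt ∪ {I.t}) ∧
    C = cut U ∧ weight x C < 2}

/-- The node `(W_s, ∅, s')`. -/
def source (I : Input V) : Node V := ⟨I.Ws, none, some I.s⟩

/-- The node `(V \ W_t, t', ∅)`. -/
def sink (I : Input V) : Node V := ⟨Finset.univ \ I.Wt, some I.t, none⟩

/-- `V(D)`: the vertex set of the auxiliary digraph. -/
def nodes (I : Input V) (x : Sym2 V → ℝ) : Set (Node V) :=
  {a | cut a.U ∈ I.narrow x ∧ I.s ∈ a.U ∧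
      (∃ v ∈ a.U ∩ I.W, a.v = some v) ∧ (∃ w ∈ I.W \ a.U, a.w = some w)} ∪
    {I.source, I.sink}

/-- `(a, b) ∈ E(D)`: the arcs of the auxiliary digraph, where `w₁` is the third entry of `a` and
`v₂` is the second entry of `b`. -/
def IsArc (I : Input V) (x : Sym2 V → ℝ) (a b : Node V) (w₁ v₂ : V) : Prop :=
  a ∈ I.nodes x ∧ b ∈ I.nodes x ∧ a.w = some w₁ ∧ b.v = some v₂ ∧
    a.U ⊂ b.U ∧ w₁ ∈ b.U \ a.U ∧ v₂ ∈ b.U \ a.U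

/-- The sub-instance of an arc from `(U₁, v₁, w₁)` to `(U₂, v₂, w₂)`. -/
def sub (I : Input V) (x : Sym2 V → ℝ) (U₁ : Finset V) (w₁ : V) (U₂ : Finset V) (v₂ : V) :
    Input V where
  Ws := U₁
  Wt := Finset.univ \ U₂
  s := w₁
  t := v₂
  B := {C | C ∈ I.narrow x ∪ I.B ∧
    ∃ U : Finset V, C = cut U ∧ U₁ ∪ {w₁} ⊆ U ∧ U ⊆ U₂ \ {v₂}}

/-- The nodes `p 0, p 1, …, p (m + 1)` form a path from the source to the sink in the auxiliary
digraph (values `p j` with `j > m + 1` are irrelevant).  Its nodes are distinct, because the sets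
grow strictly along every arc. -/
def IsPath (I : Input V) (x : Sym2 V → ℝ) (m : ℕ) (p : ℕ → Node V) : Prop :=
  p 0 = I.source ∧ p (m + 1) = I.sink ∧
    ∀ j ≤ m, ∃ w₁ v₂, I.IsArc x (p j) (p (j + 1)) w₁ v₂

end Input

/-- The cost `d(a)` of an arc with head `b`, where `o` is the output of its sub-instance and
`lam` the coefficient of the next level.  If the third entry of `b` is absent, `b.link` is empty
and the last term is zero. -/
noncomputable def arcCost [MetricSpace V] (lam : ℝ) (b : Node V) (o : Output V) : ℝ :=
  setCost o.S + lam * vecCost o.y + (1 + lam) * setCost b.link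

/-- The cost `d(P)` of the path `p 0, …, p (m + 1)`, where `out a b` is the output of the
sub-instance of the arc `(a, b)`. -/
noncomputable def pathCost [MetricSpace V] (lam : ℝ) (out : Node V → Node V → Output V)
    (m : ℕ) (p : ℕ → Node V) : ℝ :=
  ∑ j ∈ Finset.range (m + 1), arcCost lam (p (j + 1)) (out (p j) (p (j + 1)))

/-- The tree assembled along the path. -/
def pathTree (out : Node V → Node V → Output V) (m : ℕ) (p : ℕ → Node V) : Finset (Sym2 V) :=
  ((Finset.range (m + 1)).biUnion fun j => (out (p j) (p (j + 1))).S) ∪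
    (Finset.range (m + 2)).biUnion fun j => (p j).link

/-- The vector `y'` assembled along the path. -/
def pathVec (out : Node V → Node V → Output V) (m : ℕ) (p : ℕ → Node V) : Sym2 V → ℝ :=
  ∑ j ∈ Finset.range (m + 1), (out (p j) (p (j + 1))).y +
    ∑ j ∈ Finset.Icc 1 m, incidence (p j).link

/-- The set of cuts assembled along the path. -/
def pathCuts (out : Node V → Node V → Output V) (m : ℕ) (p : ℕ → Node V) :
    Set (Finset (Sym2 V)) :=
  {C | ∃ j ≤ m, C ∈ (out (p j) (p (j + 1))).L} ∪ {C | ∃ j ∈ Finset.Icc 1 m, C = cut (p j).U}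

/-- `Returns k l I o`: called on level `l` (of `k` levels) with input `I`, the dynamic program may
return `o`.  It is a relation because optimum LP solutions, cheapest trees and shortest paths need
not be unique: every choice is allowed. -/
inductive Returns [MetricSpace V] (k : ℕ) : ℕ → Input V → Output V → Prop
  | final (I : Input V) (x : Sym2 V → ℝ) (S : Finset (Sym2 V))
      (hx : I.IsOptimal x) (hS : IsMinTreeOn I.W S) :
      Returns k k I ⟨S, x, ∅⟩
  | step (l : ℕ) (hl : l < k) (I : Input V) (x : Sym2 V → ℝ) (hx : I.IsOptimal x)
      (out : Node V → Node V → Output V)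
      (hout : ∀ a b w₁ v₂, I.IsArc x a b w₁ v₂ →
        Returns k (l + 1) (I.sub x a.U w₁ b.U v₂) (out a b))
      (m : ℕ) (p : ℕ → Node V) (hp : I.IsPath x m p)
      (hmin : ∀ m' p', I.IsPath x m' p' →
        pathCost (coeff k (l + 1)) out m p ≤ pathCost (coeff k (l + 1)) out m' p') :
      Returns k l I
        ⟨pathTree out m p,
          ((coeff k l - coeff k (l + 1)) / coeff k l) • x +
            (coeff k (l + 1) / coeff k l) • pathVec out m p,
          pathCuts out m p⟩

/-- The input of the top-level call: `W_s = W_t = ∅`, `s' = s`, `t' = t`, no busy cuts. -/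
def topInput (s t : V) : Input V := ⟨∅, ∅, s, t, ∅⟩

end PathTSP

set_option linter.unusedSectionVars false

/-! Two inductions over the levels carry the theorem: one bounds cuts from below, the other bounds
cost from above.

Cuts (`Returns.invariant`). On level `l` the output is a tree `S` with an LP-feasible `y` such that
every cut separating `s'` from `t'` that `S` meets evenly satisfies `λ_l y(δ(U)) ≥ 2λ_l - λ_k`, and
even `≥ 3λ_l` if it is busy. By `Fractional.join_cut` and `chain_join`, a cut through the
concatenated parts is crossed by `y'` at least three times, is met oddly by the tree, or lives
inside a single part. In the last case a narrow or busy cut is busy for that part, so induction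
again gives `y' ≥ 3`; a cut that is not narrow has `x* ≥ 2` instead. The recurrence `λ_l = 2λ_{l+1}
+ λ_k` makes both cases yield `2λ_l - λ_k`. On level 1 this number is 1. Cuts not separating `s`
from `t` have `y ≥ 2` and `λ_1 ≥ 1/2`, and a parity count translates evenness of `S` into oddness of
`|U ∩ T|`.

Cost (`Returns.cost_le`). For any tour `H` of the instance with at least three edges in each busy
cut, `c(S) + λ_l c(y) ≤ (1 + λ_l) c(H)`. Cutting `H` at its lonely edges, those that are its only
edge in some narrow cut, gives a path in `D` (`TourOn.exists_path`). Each piece again crosses the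
busy cuts of its sub-instance three times (`TourOn.sub`), so induction bounds this path, and the
shortest path costs no more. An optimum tour and `1 + λ_1 ≤ 3/2 + ε` finish the proof. -/

namespace PathTSP

variable {V : Type*} [Fintype V] [DecidableEq V]

/-! ### Cuts and the weights of vectors on them. -/

section Cuts

variable {U U' W : Finset V} {x : Sym2 V → ℝ}

theorem mk_mem_cut {u v : V} :
    s(u, v) ∈ cut U ↔ (u ∈ U ∧ v ∉ U) ∨ (v ∈ U ∧ u ∉ U) := by
  simp only [cut, Finset.mem_filter, Finset.mem_univ, true_and]
  constructor
  · rintro ⟨a, ha, b, hb, h⟩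
    rcases Sym2.eq_iff.1 h with ⟨rfl, rfl⟩ | ⟨rfl, rfl⟩
    · exact Or.inl ⟨ha, hb⟩
    · exact Or.inr ⟨ha, hb⟩
  · rintro (⟨h, h'⟩ | ⟨h, h'⟩)
    · exact ⟨u, h, v, h', rfl⟩
    · exact ⟨v, h, u, h', Sym2.eq_swap⟩

theorem mk_mem_edgesIn {u v : V} : s(u, v) ∈ edgesIn W ↔ u ∈ W ∧ v ∈ W ∧ u ≠ v := by
  simp [edgesIn, and_assoc]

theorem edgesIn_mono (h : U ⊆ W) : edgesIn U ⊆ edgesIn W := by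
  intro e
  induction e with | _ u v
  simp only [mk_mem_edgesIn]
  exact fun ⟨hu, hv, huv⟩ => ⟨h hu, h hv, huv⟩

theorem not_isDiag_of_mem_edgesIn {e : Sym2 V} (h : e ∈ edgesIn W) : ¬ e.IsDiag :=
  (Finset.mem_filter.1 h).2

theorem cut_compl (U : Finset V) : cut Uᶜ = cut U := by
  ext e
  induction e with | _ u v
  simp only [mk_mem_cut, Finset.mem_compl]
  tauto

theorem mem_cut_congr {e : Sym2 V} (he : e ∈ edgesIn W) (h : U ∩ W = U' ∩ W) :
    e ∈ cut U ↔ e ∈ cut U' := by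
  induction e with | _ u v
  obtain ⟨hu, hv, -⟩ := mk_mem_edgesIn.1 he
  have h1 := Finset.ext_iff.1 h u
  have h2 := Finset.ext_iff.1 h v
  simp only [Finset.mem_inter, hu, hv, and_true] at h1 h2
  simp only [mk_mem_cut, h1, h2]

/-- A vector supported on `E[W]` sees only the trace of `U` on `W`. This lets cuts of all of `V` be
used on every level of the recursion. -/
theorem weight_cut_congr (hx : ∀ e, e ∉ edgesIn W → x e = 0) (h : U ∩ W = U' ∩ W) :
    weight x (cut U) = weight x (cut U') := by
  have key : ∀ U : Finset V, weight x (cut U) = ∑ e ∈ edgesIn W, if e ∈ cut U then x e else 0 := by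
    intro U
    rw [← Finset.sum_filter, weight]
    symm
    apply Finset.sum_subset_zero_on_sdiff
    · intro e he
      exact (Finset.mem_filter.1 he).2
    · intro e he
      rw [Finset.mem_sdiff, Finset.mem_filter] at he
      exact hx e fun h => he.2 ⟨h, he.1⟩
    · exact fun _ _ => rfl
  rw [key, key]
  refine Finset.sum_congr rfl fun e he => ?_
  simp only [mem_cut_congr he h]

theorem inter_cut_congr {S : Finset (Sym2 V)} (hS : S ⊆ edgesIn W) (h : U ∩ W = U' ∩ W) :
    S ∩ cut U = S ∩ cut U' := by
  ext e
  simp only [Finset.mem_inter]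
  exact and_congr_right fun he => mem_cut_congr (hS he) h

theorem cut_empty : cut (∅ : Finset V) = ∅ := by
  ext e
  induction e with | _ u v
  simp [mk_mem_cut]

theorem cut_univ : cut (Finset.univ : Finset V) = ∅ := by
  ext e
  induction e with | _ u v
  simp [mk_mem_cut]

theorem weight_cut_of_disjoint (hx : ∀ e, e ∉ edgesIn W → x e = 0) (h : Disjoint U W) :
    weight x (cut U) = 0 := by
  rw [weight_cut_congr hx (U' := ∅) (by simpa using Finset.disjoint_iff_inter_eq_empty.1 h),
    cut_empty]
  simp [weight]

theorem weight_cut_of_subset (hx : ∀ e, e ∉ edgesIn W → x e = 0) (h : W ⊆ U) :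
    weight x (cut U) = 0 := by
  rw [weight_cut_congr hx (U' := Finset.univ)
    (by rw [Finset.inter_eq_right.2 h, Finset.univ_inter]), cut_univ]
  simp [weight]

theorem inter_cut_of_disjoint {S : Finset (Sym2 V)} (hS : S ⊆ edgesIn W) (h : Disjoint U W) :
    S ∩ cut U = ∅ := by
  rw [inter_cut_congr hS (U' := ∅) (by simpa using Finset.disjoint_iff_inter_eq_empty.1 h),
    cut_empty, Finset.inter_empty]

theorem inter_cut_of_subset {S : Finset (Sym2 V)} (hS : S ⊆ edgesIn W) (h : W ⊆ U) :
    S ∩ cut U = ∅ := by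
  rw [inter_cut_congr hS (U' := Finset.univ)
    (by rw [Finset.inter_eq_right.2 h, Finset.univ_inter]), cut_univ, Finset.inter_empty]

theorem weight_nonneg (hx : ∀ e, 0 ≤ x e) (F : Finset (Sym2 V)) : 0 ≤ weight x F :=
  Finset.sum_nonneg fun e _ => hx e

theorem weight_add (x y : Sym2 V → ℝ) (F : Finset (Sym2 V)) :
    weight (x + y) F = weight x F + weight y F := Finset.sum_add_distrib

theorem weight_smul (r : ℝ) (x : Sym2 V → ℝ) (F : Finset (Sym2 V)) :
    weight (r • x) F = r * weight x F := by
  simp [weight, Finset.mul_sum]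

theorem weight_incidence (F C : Finset (Sym2 V)) : weight (incidence F) C = #(F ∩ C) := by
  simp [weight, incidence, Finset.inter_comm]

end Cuts

/-! ### Trees on subsets of the vertices. -/

section Trees

variable {W : Finset V} {S : Finset (Sym2 V)}

theorem reachable_induce (hS : S ⊆ edgesIn W) {u v : V} (hu : u ∈ W) (hv : v ∈ W)
    (h : (SimpleGraph.fromEdgeSet (S : Set (Sym2 V))).Reachable u v) :
    ((SimpleGraph.fromEdgeSet (S : Set (Sym2 V))).induce (W : Set V)).Reachable
      ⟨u, hu⟩ ⟨v, hv⟩ := by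
  obtain ⟨p⟩ := h
  induction p with
  | nil => exact SimpleGraph.Reachable.refl _
  | cons hadj p ih =>
    have h1 := (SimpleGraph.fromEdgeSet_adj _).1 hadj
    have h2 := (mk_mem_edgesIn.1 (hS (Finset.mem_coe.1 h1.1))).2.1
    exact (SimpleGraph.Adj.reachable (by simpa using h1)).trans (ih h2 hv)

/-- Connectedness plus the edge count, phrased in the ambient graph so that gluing trees avoids
subtypes. -/
theorem isTreeOn_iff : IsTreeOn W S ↔ S ⊆ edgesIn W ∧ W.Nonempty ∧
    (∀ u ∈ W, ∀ v ∈ W, (SimpleGraph.fromEdgeSet (S : Set (Sym2 V))).Reachable u v) ∧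
    #S + 1 = #W := by
  unfold IsTreeOn
  refine and_congr_right fun hS => ?_
  set G := SimpleGraph.fromEdgeSet (S : Set (Sym2 V))
  have hcard : Nat.card (G.induce (W : Set V)).edgeSet = #S := by
    have himg : Sym2.map (fun v : {v // v ∈ (W : Set V)} => v.1) '' (G.induce (W : Set V)).edgeSet
        = (S : Set (Sym2 V)) := by
      ext e
      constructor
      · rintro ⟨e', he', rfl⟩
        induction e' with | _ a b
        simp only [SimpleGraph.mem_edgeSet, SimpleGraph.comap_adj] at he'
        exact ((SimpleGraph.fromEdgeSet_adj _).1 he').1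
      · intro he
        have h := hS (Finset.mem_coe.1 he)
        induction e with | _ a b
        obtain ⟨ha, hb, hab⟩ := mk_mem_edgesIn.1 h
        refine ⟨s(⟨a, ha⟩, ⟨b, hb⟩), ?_, rfl⟩
        simp only [SimpleGraph.mem_edgeSet, SimpleGraph.comap_adj]
        exact (SimpleGraph.fromEdgeSet_adj _).2 ⟨he, hab⟩
    rw [Nat.card_coe_set_eq,
      ← Set.ncard_image_of_injective _ (Sym2.map.injective Subtype.val_injective), himg,
      Set.ncard_coe_finset]
  have hcardW : Nat.card ((W : Set V) : Type _) = #W := by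
    rw [Nat.card_coe_set_eq, Set.ncard_coe_finset]
  rw [SimpleGraph.isTree_iff_connected_and_card, hcard, hcardW, ← and_assoc]
  refine and_congr_left fun _ => ?_
  constructor
  · intro h
    obtain ⟨⟨w, hw⟩⟩ := h.nonempty
    refine ⟨⟨w, hw⟩, fun u hu v hv => ?_⟩
    exact (h.preconnected ⟨u, hu⟩ ⟨v, hv⟩).map (SimpleGraph.Embedding.induce _).toHom
  · rintro ⟨⟨w, hw⟩, h⟩
    have : Nonempty (W : Set V) := ⟨⟨w, hw⟩⟩
    exact ⟨fun u v => reachable_induce hS u.2 v.2 (h u u.2 v v.2)⟩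

/-- Two disjoint trees and an edge between them form a tree. -/
theorem IsTreeOn.join {W₁ W₂ : Finset V} {S₁ S₂ : Finset (Sym2 V)} (h₁ : IsTreeOn W₁ S₁)
    (h₂ : IsTreeOn W₂ S₂) (hW : Disjoint W₁ W₂) {u v : V} (hu : u ∈ W₁) (hv : v ∈ W₂) :
    IsTreeOn (W₁ ∪ W₂) (S₁ ∪ S₂ ∪ {s(u, v)}) := by
  rw [isTreeOn_iff] at *
  obtain ⟨hS₁, hn₁, hr₁, hc₁⟩ := h₁
  obtain ⟨hS₂, hn₂, hr₂, hc₂⟩ := h₂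
  have huv : u ≠ v := fun h => Finset.disjoint_left.1 hW hu (h ▸ hv)
  have hdis : Disjoint S₁ S₂ := by
    refine Finset.disjoint_left.2 fun e he he' => ?_
    induction e with | _ a b
    exact Finset.disjoint_left.1 hW (mk_mem_edgesIn.1 (hS₁ he)).1 (mk_mem_edgesIn.1 (hS₂ he')).1
  have hdis' : Disjoint (S₁ ∪ S₂) {s(u, v)} := by
    rw [Finset.disjoint_singleton_right, Finset.mem_union]
    rintro (h | h)
    · exact Finset.disjoint_left.1 hW (mk_mem_edgesIn.1 (hS₁ h)).2.1 hv
    · exact Finset.disjoint_left.1 hW hu (mk_mem_edgesIn.1 (hS₂ h)).1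
  set S := S₁ ∪ S₂ ∪ {s(u, v)} with hS
  have hle₁ : SimpleGraph.fromEdgeSet (S₁ : Set (Sym2 V)) ≤ SimpleGraph.fromEdgeSet (S : Set _) :=
    SimpleGraph.fromEdgeSet_mono (by rw [hS]; intro e he; simp_all)
  have hle₂ : SimpleGraph.fromEdgeSet (S₂ : Set (Sym2 V)) ≤ SimpleGraph.fromEdgeSet (S : Set _) :=
    SimpleGraph.fromEdgeSet_mono (by rw [hS]; intro e he; simp_all)
  have hr : ∀ a ∈ W₁ ∪ W₂, (SimpleGraph.fromEdgeSet (S : Set (Sym2 V))).Reachable u a := by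
    intro a ha
    rcases Finset.mem_union.1 ha with ha | ha
    · exact (hr₁ u hu a ha).mono hle₁
    · refine SimpleGraph.Reachable.trans (SimpleGraph.Adj.reachable ?_) ((hr₂ v hv a ha).mono hle₂)
      exact (SimpleGraph.fromEdgeSet_adj _).2 ⟨by simp [hS], huv⟩
  refine ⟨?_, hn₁.mono Finset.subset_union_left, fun a ha b hb => (hr a ha).symm.trans (hr b hb), ?_⟩
  · refine Finset.union_subset (Finset.union_subset ?_ ?_) ?_
    · exact hS₁.trans (edgesIn_mono Finset.subset_union_left)
    · exact hS₂.trans (edgesIn_mono Finset.subset_union_right)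
    · simp [mk_mem_edgesIn, hu, hv, huv]
  · rw [hS, Finset.card_union_of_disjoint hdis', Finset.card_union_of_disjoint hdis,
      Finset.card_union_of_disjoint hW, Finset.card_singleton]
    omega

end Trees

end PathTSP

namespace PathTSP

variable {V : Type*} [Fintype V] [DecidableEq V]

/-! ### Fractional tours and their concatenation. -/

section Fractional

/-- `x` satisfies the constraints of the linear program for `s`-`t`-tours of `W`, in a form that
applies to arbitrary vertex sets `U`. -/
structure Fractional (W : Finset V) (s t : V) (x : Sym2 V → ℝ) : Prop where
  s_mem : s ∈ W
  t_mem : t ∈ W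
  nonneg : ∀ e, 0 ≤ x e
  support : ∀ e, e ∉ edgesIn W → x e = 0
  two_le : ∀ U : Finset V, s ∉ U → t ∉ U → ¬ Disjoint U W → 2 ≤ weight x (cut U)
  one_le : ∀ U : Finset V, s ∈ U → t ∉ U → 1 ≤ weight x (cut U)

namespace Fractional

variable {W : Finset V} {s t : V} {x : Sym2 V → ℝ}

theorem two_le_of_mem (h : Fractional W s t x) {U : Finset V} (hs : s ∈ U) (ht : t ∈ U)
    (hW : ¬ W ⊆ U) : 2 ≤ weight x (cut U) := by
  rw [← cut_compl]
  refine h.two_le _ (by simpa) (by simpa) ?_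
  rwa [Finset.disjoint_left, ← not_iff_not.2 (show W ⊆ U ↔ _ from ?_)]
  constructor
  · exact fun h' a ha ha' => (Finset.mem_compl.1 ha) (h' ha')
  · exact fun h' a ha => by_contra fun hn => h' (Finset.mem_compl.2 hn) ha

theorem one_le' (h : Fractional W s t x) {U : Finset V} (hs : s ∉ U) (ht : t ∈ U) :
    1 ≤ weight x (cut U) := by
  rw [← cut_compl]
  exact h.one_le _ (by simpa) (by simpa)

theorem combine (h : Fractional W s t x) {y : Sym2 V → ℝ} (h' : Fractional W s t y) {α β : ℝ}
    (hα : 0 ≤ α) (hβ : 0 ≤ β) (hαβ : α + β = 1) : Fractional W s t (α • x + β • y) where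
  s_mem := h.s_mem
  t_mem := h.t_mem
  nonneg e := add_nonneg (mul_nonneg hα (h.nonneg e)) (mul_nonneg hβ (h'.nonneg e))
  support e he := by simp [h.support e he, h'.support e he]
  two_le U hs ht hU := by
    rw [weight_add, weight_smul, weight_smul]
    nlinarith [h.two_le U hs ht hU, h'.two_le U hs ht hU]
  one_le U hs ht := by
    rw [weight_add, weight_smul, weight_smul]
    nlinarith [h.one_le U hs ht, h'.one_le U hs ht]

section Join

variable {W₁ W₂ : Finset V} {s₁ t₁ s₂ t₂ : V} {y₁ y₂ : Sym2 V → ℝ}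

theorem weight_incidence_cut {U : Finset V} {u v : V} (h : ¬(u ∈ U ↔ v ∈ U)) :
    weight (incidence {s(u, v)}) (cut U) = 1 := by
  have : s(u, v) ∈ cut U := by rw [mk_mem_cut]; tauto
  rw [weight_incidence, Finset.singleton_inter_of_mem this]
  simp

theorem incidence_nonneg (F : Finset (Sym2 V)) (e : Sym2 V) : 0 ≤ incidence F e := by
  unfold incidence
  split_ifs <;> norm_num

theorem join (h₁ : Fractional W₁ s₁ t₁ y₁) (h₂ : Fractional W₂ s₂ t₂ y₂) (hW : Disjoint W₁ W₂) :
    Fractional (W₁ ∪ W₂) s₁ t₂ (y₁ + y₂ + incidence {s(t₁, s₂)}) where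
  s_mem := Finset.mem_union_left _ h₁.s_mem
  t_mem := Finset.mem_union_right _ h₂.t_mem
  nonneg e := add_nonneg (add_nonneg (h₁.nonneg e) (h₂.nonneg e)) (incidence_nonneg _ e)
  support e he := by
    have h1 := h₁.support e fun h => he (edgesIn_mono Finset.subset_union_left h)
    have h2 := h₂.support e fun h => he (edgesIn_mono Finset.subset_union_right h)
    have h3 : e ∉ ({s(t₁, s₂)} : Finset (Sym2 V)) := by
      rintro h
      rw [Finset.mem_singleton] at h
      subst h
      refine he (mk_mem_edgesIn.2 ⟨Finset.mem_union_left _ h₁.t_mem,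
        Finset.mem_union_right _ h₂.s_mem, ?_⟩)
      exact fun h => Finset.disjoint_left.1 hW h₁.t_mem (h ▸ h₂.s_mem)
    simp [h1, h2, incidence, Finset.mem_singleton.not.1 h3]
  two_le U hs ht hU := by
    rw [weight_add, weight_add]
    have n1 := weight_nonneg h₁.nonneg (cut U)
    have n2 := weight_nonneg h₂.nonneg (cut U)
    have n3 := weight_nonneg (incidence_nonneg {s(t₁, s₂)}) (cut U)
    -- `t₁ ∈ U` forces one unit from `y₁`, `s₂ ∈ U` one from `y₂`, and exactly one of them in `U`
    -- forces one from the link. If neither is in `U`, a part that meets `U` supplies both units.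
    by_cases a : t₁ ∈ U <;> by_cases b : s₂ ∈ U
    · linarith [h₁.one_le' hs a, h₂.one_le U b ht]
    · linarith [h₁.one_le' hs a, weight_incidence_cut (U := U) (u := t₁) (v := s₂) (by tauto)]
    · linarith [h₂.one_le U b ht, weight_incidence_cut (U := U) (u := t₁) (v := s₂) (by tauto)]
    · rw [Finset.disjoint_union_right, not_and_or] at hU
      rcases hU with hU | hU
      · linarith [h₁.two_le U hs a hU]
      · linarith [h₂.two_le U b ht hU]
  one_le U hs ht := by
    rw [weight_add, weight_add]
    have n1 := weight_nonneg h₁.nonneg (cut U)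
    have n2 := weight_nonneg h₂.nonneg (cut U)
    have n3 := weight_nonneg (incidence_nonneg {s(t₁, s₂)}) (cut U)
    by_cases a : t₁ ∈ U <;> by_cases b : s₂ ∈ U
    · linarith [h₂.one_le U b ht]
    · linarith [weight_incidence_cut (U := U) (u := t₁) (v := s₂) (by tauto)]
    · linarith [h₁.one_le U hs a]
    · linarith [h₁.one_le U hs a]

/-- A cut that separates the endpoints of a join is crossed three times, or it is one of the cuts
between the two parts, or it cuts only one of the parts. -/
theorem join_cut (h₁ : Fractional W₁ s₁ t₁ y₁) (h₂ : Fractional W₂ s₂ t₂ y₂)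
    {S₁ S₂ : Finset (Sym2 V)} (hS₁ : S₁ ⊆ edgesIn W₁) (hS₂ : S₂ ⊆ edgesIn W₂)
    {U : Finset V} (hs : s₁ ∈ U) (ht : t₂ ∉ U) :
    3 ≤ weight (y₁ + y₂ + incidence {s(t₁, s₂)}) (cut U) ∨
    Odd #((S₁ ∪ S₂ ∪ {s(t₁, s₂)}) ∩ cut U) ∨
    (t₁ ∉ U ∧ Disjoint U W₂ ∧
      weight (y₁ + y₂ + incidence {s(t₁, s₂)}) (cut U) = weight y₁ (cut U) ∧
      (S₁ ∪ S₂ ∪ {s(t₁, s₂)}) ∩ cut U = S₁ ∩ cut U) ∨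
    (s₂ ∈ U ∧ W₁ ⊆ U ∧
      weight (y₁ + y₂ + incidence {s(t₁, s₂)}) (cut U) = weight y₂ (cut U) ∧
      (S₁ ∪ S₂ ∪ {s(t₁, s₂)}) ∩ cut U = S₂ ∩ cut U) := by
  rw [weight_add, weight_add, Finset.union_inter_distrib_right, Finset.union_inter_distrib_right]
  have n1 := weight_nonneg h₁.nonneg (cut U)
  have n2 := weight_nonneg h₂.nonneg (cut U)
  have n3 := weight_nonneg (incidence_nonneg {s(t₁, s₂)}) (cut U)
  -- Each part contributes 0 if uncut, at least 1 if its ends are separated, at least 2 if it is cut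
  -- without separating its ends. If only the link crosses, the tree meets the cut in exactly one
  -- edge.
  by_cases a : t₁ ∈ U <;> by_cases b : s₂ ∈ U
  · by_cases c : W₁ ⊆ U
    · refine Or.inr (Or.inr (Or.inr ⟨b, c, ?_, ?_⟩))
      · rw [weight_cut_of_subset h₁.support c, weight_incidence, Finset.singleton_inter_of_notMem]
        · simp
        · simp [mk_mem_cut, a, b]
      · rw [inter_cut_of_subset hS₁ c, Finset.singleton_inter_of_notMem]
        · simp
        · simp [mk_mem_cut, a, b]
    · left
      linarith [h₁.two_le_of_mem hs a c, h₂.one_le U b ht]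
  · have h3 := weight_incidence_cut (U := U) (u := t₁) (v := s₂) (by tauto)
    by_cases c : W₁ ⊆ U
    · by_cases d : Disjoint U W₂
      · right; left
        rw [inter_cut_of_subset hS₁ c, inter_cut_of_disjoint hS₂ d,
          Finset.singleton_inter_of_mem (mk_mem_cut.2 (Or.inl ⟨a, b⟩))]
        simp
      · left
        linarith [h₂.two_le U b ht d]
    · left
      linarith [h₁.two_le_of_mem hs a c]
  · have h3 := weight_incidence_cut (U := U) (u := t₁) (v := s₂) (by tauto)
    left
    linarith [h₁.one_le U hs a, h₂.one_le U b ht]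
  · by_cases d : Disjoint U W₂
    · refine Or.inr (Or.inr (Or.inl ⟨a, d, ?_, ?_⟩))
      · rw [weight_cut_of_disjoint h₂.support d, weight_incidence,
          Finset.singleton_inter_of_notMem]
        · simp
        · simp [mk_mem_cut, a, b]
      · rw [inter_cut_of_disjoint hS₂ d, Finset.singleton_inter_of_notMem]
        · simp
        · simp [mk_mem_cut, a, b]
    · left
      linarith [h₁.one_le U hs a, h₂.two_le U b ht d]

end Join

end Fractional

/-- The LP constrains only subsets of `W`; replacing `U` by `U ∩ W` extends the constraints to all
vertex sets. -/
theorem Input.IsFeasible.fractional {I : Input V} {x : Sym2 V → ℝ} (h : I.IsFeasible x)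
    (hs : I.s ∈ I.W) (ht : I.t ∈ I.W) : Fractional I.W I.s I.t x where
  s_mem := hs
  t_mem := ht
  nonneg e := by
    by_cases he : e ∈ edgesIn I.W
    · exact h.nonneg e he
    · exact (h.support e he).ge
  support := h.support
  two_le U hsU htU hU := by
    rw [weight_cut_congr h.support (U' := U ∩ I.W) (by simp)]
    refine h.two_le _ (Finset.not_disjoint_iff_nonempty_inter.1 hU) fun v hv => ?_
    rw [Finset.mem_inter] at hv
    simp only [Finset.mem_sdiff, Finset.mem_insert, Finset.mem_singleton]
    refine ⟨hv.2, ?_⟩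
    rintro (rfl | rfl)
    · exact hsU hv.1
    · exact htU hv.1
  one_le U hsU htU := by
    rw [weight_cut_congr h.support (U' := U ∩ I.W) (by simp)]
    refine h.one_le _ (by simp [hsU, hs]) fun v hv => ?_
    rw [Finset.mem_inter] at hv
    simp only [Finset.mem_sdiff, Finset.mem_singleton]
    exact ⟨hv.2, fun h => htU (h ▸ hv.1)⟩

end Fractional

end PathTSP

namespace PathTSP

variable {V : Type*} [Fintype V] [DecidableEq V]

/-! ### Concatenating the parts along a path of the digraph. -/

section Chain

variable {A : ℕ → Finset V} {v w : ℕ → V} {y : ℕ → Sym2 V → ℝ} {S F : ℕ → Finset (Sym2 V)}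

/-- Solutions on the parts `A (i + 1) \ A i`, joined by the edges `F i`. -/
theorem chain_join (m : ℕ) (hA : ∀ i ≤ m, A i ⊆ A (i + 1))
    (hy : ∀ i ≤ m, Fractional (A (i + 1) \ A i) (w i) (v i) (y i))
    (hS : ∀ i ≤ m, IsTreeOn (A (i + 1) \ A i) (S i))
    (hF₀ : F 0 = ∅) (hF : ∀ i < m, F (i + 1) = {s(v i, w (i + 1))}) :
    ∀ j ≤ m, A 0 ⊆ A (j + 1) ∧
      Fractional (A (j + 1) \ A 0) (w 0) (v j)
        (∑ i ∈ Finset.range (j + 1), y i + ∑ i ∈ Finset.Icc 1 j, incidence (F i)) ∧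
      IsTreeOn (A (j + 1) \ A 0)
        ((Finset.range (j + 1)).biUnion S ∪ (Finset.range (j + 1)).biUnion F) ∧
      ∀ U : Finset V, w 0 ∈ U → v j ∉ U →
        3 ≤ weight (∑ i ∈ Finset.range (j + 1), y i + ∑ i ∈ Finset.Icc 1 j, incidence (F i))
          (cut U) ∨
        Odd #(((Finset.range (j + 1)).biUnion S ∪ (Finset.range (j + 1)).biUnion F) ∩ cut U) ∨
        ∃ i ≤ j, A i \ A 0 ⊆ U ∧ w i ∈ U ∧ v i ∉ U ∧ Disjoint U (A (j + 1) \ A (i + 1)) ∧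
          weight (∑ i ∈ Finset.range (j + 1), y i + ∑ i ∈ Finset.Icc 1 j, incidence (F i))
            (cut U) = weight (y i) (cut U) ∧
          ((Finset.range (j + 1)).biUnion S ∪ (Finset.range (j + 1)).biUnion F) ∩ cut U =
            S i ∩ cut U := by
  intro j
  induction j with
  | zero =>
    intro h
    refine ⟨hA 0 h, ?_⟩
    simp only [zero_add, Finset.range_one, Finset.sum_singleton, Finset.singleton_biUnion, hF₀,
      Finset.union_empty, Finset.Icc_eq_empty_of_lt Nat.zero_lt_one,
      Finset.sum_empty, add_zero]
    exact ⟨hy 0 h, hS 0 h, fun U h1 h2 => Or.inr (Or.inr ⟨0, le_rfl, by simp, h1, h2, by simp,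
      rfl, rfl⟩)⟩
  | succ j ih =>
    intro h
    obtain ⟨hsub, hf, ht, hc⟩ := ih (by omega)
    have eY : ∑ i ∈ Finset.range (j + 1 + 1), y i + ∑ i ∈ Finset.Icc 1 (j + 1), incidence (F i) =
        (∑ i ∈ Finset.range (j + 1), y i + ∑ i ∈ Finset.Icc 1 j, incidence (F i)) + y (j + 1) +
          incidence {s(v j, w (j + 1))} := by
      rw [Finset.sum_range_succ, Finset.sum_Icc_succ_top (by omega), hF j (by omega)]
      abel
    have eT : (Finset.range (j + 1 + 1)).biUnion S ∪ (Finset.range (j + 1 + 1)).biUnion F =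
        ((Finset.range (j + 1)).biUnion S ∪ (Finset.range (j + 1)).biUnion F) ∪ S (j + 1) ∪
          {s(v j, w (j + 1))} := by
      rw [Finset.range_add_one, Finset.biUnion_insert, Finset.biUnion_insert, hF j (by omega)]
      ext e
      simp only [Finset.mem_union]
      tauto
    have hA' := hA (j + 1) h
    have eW : A (j + 1 + 1) \ A 0 = (A (j + 1) \ A 0) ∪ (A (j + 1 + 1) \ A (j + 1)) := by
      ext a
      have h1 := @hA' a
      have h2 := @hsub a
      simp only [Finset.mem_union, Finset.mem_sdiff]
      tauto
    have hdis : Disjoint (A (j + 1) \ A 0) (A (j + 1 + 1) \ A (j + 1)) :=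
      Finset.disjoint_left.2 fun a h1 h2 =>
        (Finset.mem_sdiff.1 h2).2 (Finset.mem_sdiff.1 h1).1
    refine ⟨hsub.trans hA', ?_⟩
    rw [eY, eT, eW]
    have hy' := hy (j + 1) h
    have hS' := hS (j + 1) h
    refine ⟨hf.join hy' hdis, ht.join hS' hdis hf.t_mem hy'.s_mem, fun U h1 h2 => ?_⟩
    -- If the cut lives in the old chain, the induction hypothesis localizes it further; if it lives
    -- in the new part, that part is the witness.
    rcases hf.join_cut hy' ht.1 hS'.1 h1 h2 with h3 | h3 | ⟨h3, h4, h5, h6⟩ | ⟨h3, h4, h5, h6⟩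
    · exact Or.inl h3
    · exact Or.inr (Or.inl h3)
    · rw [h5, h6]
      rcases hc U h1 h3 with h7 | h7 | ⟨i, hi, g1, g2, g3, g4, g5, g6⟩
      · exact Or.inl h7
      · exact Or.inr (Or.inl h7)
      · refine Or.inr (Or.inr ⟨i, by omega, g1, g2, g3, ?_, g5, g6⟩)
        refine Finset.disjoint_left.2 fun a ha ha' => ?_
        rw [Finset.mem_sdiff] at ha'
        by_cases hb : a ∈ A (j + 1)
        · exact Finset.disjoint_left.1 g4 ha (Finset.mem_sdiff.2 ⟨hb, ha'.2⟩)
        · exact Finset.disjoint_left.1 h4 ha (Finset.mem_sdiff.2 ⟨ha'.1, hb⟩)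
    · exact Or.inr (Or.inr ⟨j + 1, le_rfl, h4, h3, h2, by simp, h5, h6⟩)

end Chain

/-! ### The coefficients `λ_l`. -/

section Coeff

variable {k l : ℕ}

theorem coeff_denom_pos (hk : 1 ≤ k) : (0 : ℝ) < 2 ^ (k + 1) - 3 := by
  have : (2 : ℝ) ^ 2 ≤ 2 ^ (k + 1) := pow_le_pow_right₀ (by norm_num) (by omega)
  linarith

theorem coeff_pos (hk : 1 ≤ k) (l : ℕ) : 0 < coeff k l := by
  refine div_pos ?_ (coeff_denom_pos hk)
  -- Truncated subtraction keeps the exponent at least 1, so no bound on `l` is needed.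
  have : (2 : ℝ) ^ 1 ≤ 2 ^ (k - l + 1) := pow_le_pow_right₀ (by norm_num) (by omega)
  linarith

theorem coeff_eq (hl : l < k) : coeff k l = 2 * coeff k (l + 1) + coeff k k := by
  unfold coeff
  rw [show k - l + 1 = (k - (l + 1) + 1) + 1 by omega, pow_succ]
  simp only [Nat.sub_self]
  ring

theorem coeff_one (hk : 1 ≤ k) : 2 * coeff k 1 - coeff k k = 1 := by
  have := coeff_denom_pos hk
  unfold coeff
  rw [Nat.sub_add_cancel hk, Nat.sub_self, ← mul_div_assoc, div_sub_div_same,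
    div_eq_one_iff_eq this.ne']
  ring

end Coeff

/-! ### Valid inputs and the cut invariant. -/

namespace Input

/-- The conditions on the input of the dynamic program. -/
structure Valid (I : Input V) : Prop where
  disj : Disjoint I.Ws I.Wt
  s_mem : I.s ∈ I.W
  t_mem : I.t ∈ I.W
  sep : ∀ C ∈ I.B, ∃ U : Finset V, I.s ∈ U ∧ I.t ∉ U ∧ C = cut U

theorem mem_W {I : Input V} {v : V} : v ∈ I.W ↔ v ∉ I.Ws ∧ v ∉ I.Wt := by
  simp [W]

theorem sub_W (I : Input V) (x : Sym2 V → ℝ) (U₁ U₂ : Finset V) (w₁ v₂ : V) :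
    (I.sub x U₁ w₁ U₂ v₂).W = U₂ \ U₁ := by
  ext v
  simp [mem_W, sub, and_comm]

theorem IsArc.valid {I : Input V} {x : Sym2 V → ℝ} {a b : Node V} {w₁ v₂ : V}
    (h : I.IsArc x a b w₁ v₂) : (I.sub x a.U w₁ b.U v₂).Valid where
  disj := by
    refine Finset.disjoint_left.2 fun v hv hv' => ?_
    exact (Finset.mem_sdiff.1 hv').2 (h.2.2.2.2.1.1 hv)
  s_mem := by rw [sub_W]; exact h.2.2.2.2.2.1
  t_mem := by rw [sub_W]; exact h.2.2.2.2.2.2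
  sep := by
    rintro C ⟨-, U, rfl, h1, h2⟩
    refine ⟨U, h1 (by simp [sub]), fun h3 => ?_, rfl⟩
    have := h2 h3
    simp [sub] at this

end Input

/-- The invariant of the dynamic program: it returns a tree and a vector that satisfies the
constraints of the linear program and that is large on cuts of even size. -/
theorem Returns.invariant [MetricSpace V] {k l : ℕ} (hk : 1 ≤ k) {I : Input V} {o : Output V}
    (hr : Returns k l I o) (hI : I.Valid) :
    Fractional I.W I.s I.t o.y ∧ IsTreeOn I.W o.S ∧
    ∀ U : Finset V, I.Ws ∪ {I.s} ⊆ U → U ⊆ Finset.univ \ (I.Wt ∪ {I.t}) →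
      Even #(o.S ∩ cut U) →
      2 * coeff k l - coeff k k ≤ coeff k l * weight o.y (cut U) ∧
      (cut U ∈ I.B → 3 * coeff k l ≤ coeff k l * weight o.y (cut U)) := by
  induction hr with
  | final I x S hx hS =>
    have hf := hx.1.fractional hI.s_mem hI.t_mem
    refine ⟨hf, hS.1, fun U h1 h2 _ => ?_⟩
    have hs : I.s ∈ U := h1 (by simp)
    have ht : I.t ∉ U := fun h => by simpa using h2 h
    have := hf.one_le U hs ht
    have hc := coeff_pos hk k
    refine ⟨?_, fun hB => ?_⟩
    · dsimp only
      nlinarith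
    · have := hx.1.busy _ hB
      dsimp only
      nlinarith
  | step l hl I x hx out hout m p hp hmin ih =>
    obtain ⟨hp₀, hp₁, harc⟩ := hp
    have : Nonempty V := ⟨I.s⟩
    choose! w v harc using harc
    have hf := hx.1.fractional hI.s_mem hI.t_mem
    have hin := fun i (hi : i ≤ m) => ih _ _ _ _ (harc i hi) (harc i hi).valid
    simp only [Input.sub_W] at hin
    have hw₀ : w 0 = I.s := by
      have := (harc 0 (by omega)).2.2.1
      rw [hp₀] at this
      exact (Option.some.inj this).symm
    have hvm : v m = I.t := by
      have := (harc m le_rfl).2.2.2.1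
      rw [hp₁] at this
      exact (Option.some.inj this).symm
    have hlink₀ : (p 0).link = ∅ := by rw [hp₀]; rfl
    have hlinkm : (p (m + 1)).link = ∅ := by rw [hp₁]; rfl
    have hlink : ∀ i < m, (p (i + 1)).link = {s(v i, w (i + 1))} := by
      intro i hi
      have h1 := (harc i (by omega)).2.2.2.1
      have h2 := (harc (i + 1) (by omega)).2.2.1
      simp only [Node.link, h1, h2]
    have hchain := chain_join (A := fun i => (p i).U) (v := v) (w := w)
      (y := fun i => (out (p i) (p (i + 1))).y) (S := fun i => (out (p i) (p (i + 1))).S)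
      (F := fun i => (p i).link) m (fun i hi => (harc i hi).2.2.2.2.1.1)
      (fun i hi => (hin i hi).1) (fun i hi => (hin i hi).2.1) hlink₀ hlink m le_rfl
    obtain ⟨-, hY, hT, hcut⟩ := hchain
    -- The sink has no link, so the index `m + 1` may be dropped to match `chain_join`.
    have eT : pathTree out m p =
        ((Finset.range (m + 1)).biUnion fun i => (out (p i) (p (i + 1))).S) ∪
          (Finset.range (m + 1)).biUnion fun i => (p i).link := by
      rw [pathTree, Finset.range_add_one (n := m + 1), Finset.biUnion_insert, hlinkm,
        Finset.empty_union]
    have eW : (p (m + 1)).U \ (p 0).U = I.W := by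
      rw [hp₀, hp₁]
      ext a
      simp [Input.mem_W, Input.source, Input.sink, and_comm]
    rw [eW, hw₀, hvm] at hY
    rw [eW] at hT
    rw [hw₀, hvm] at hcut
    simp only [← eT] at hT hcut
    change Fractional _ _ _ (pathVec out m p) at hY
    have hc := coeff_pos hk l
    have hc' := coeff_pos hk (l + 1)
    have hck := coeff_pos hk k
    have hceq := coeff_eq hl
    have hα : 0 ≤ (coeff k l - coeff k (l + 1)) / coeff k l :=
      div_nonneg (by linarith) hc.le
    have hβ : 0 ≤ coeff k (l + 1) / coeff k l := div_nonneg hc'.le hc.le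
    refine ⟨hf.combine hY hα hβ (by field_simp; ring), hT, fun U h1 h2 heven => ?_⟩
    have hs : I.s ∈ U := h1 (by simp)
    have ht : I.t ∉ U := fun h => by simpa using h2 h
    have hWs : I.Ws ⊆ U := Finset.subset_union_left.trans h1
    have hWt : Disjoint U I.Wt := Finset.disjoint_left.2 fun a ha ha' => by
      have := h2 ha
      simp [ha'] at this
    dsimp only at heven ⊢
    have hx1 := hf.one_le U hs ht
    rw [weight_add, weight_smul, weight_smul]
    have hmul : coeff k l * ((coeff k l - coeff k (l + 1)) / coeff k l * weight x (cut U) +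
        coeff k (l + 1) / coeff k l * weight (pathVec out m p) (cut U)) =
        (coeff k l - coeff k (l + 1)) * weight x (cut U) +
          coeff k (l + 1) * weight (pathVec out m p) (cut U) := by
      field_simp
    rw [hmul]
    -- Either `y'` crosses the cut three times, or the cut is neither narrow nor busy and only the
    -- weaker bound of the next level is available. A narrow or busy cut localized in part `i`
    -- belongs to the busy set of that sub-instance.
    have hkey : 3 * coeff k (l + 1) ≤ coeff k (l + 1) * weight (pathVec out m p) (cut U) ∨
        (2 * coeff k (l + 1) - coeff k k ≤
          coeff k (l + 1) * weight (pathVec out m p) (cut U) ∧ ¬(cut U ∈ I.narrow x ∪ I.B)) := by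
      rcases hcut U hs ht with h3 | h3 | ⟨i, hi, g1, g2, g3, g4, g5, g6⟩
      · left
        change 3 ≤ weight (pathVec out m p) (cut U) at h3
        nlinarith
      · exact absurd heven (Nat.not_even_iff_odd.2 h3)
      · change weight (pathVec out m p) (cut U) = _ at g5
        have hsub1 : (p i).U ∪ {w i} ⊆ U := by
          refine Finset.union_subset (fun a ha => ?_) (by simpa using g2)
          by_cases ha' : a ∈ I.Ws
          · exact hWs ha'
          · exact g1 (by simp [hp₀, Input.source, ha, ha'])
        have hsub2 : U ⊆ (p (i + 1)).U \ {v i} := by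
          intro a ha
          rw [Finset.mem_sdiff, Finset.mem_singleton]
          refine ⟨?_, fun h => g3 (h ▸ ha)⟩
          by_contra hn
          refine Finset.disjoint_left.1 g4 ha (Finset.mem_sdiff.2 ⟨?_, hn⟩)
          simp [hp₁, Input.sink, Finset.disjoint_left.1 hWt ha]
        have hI' := (hin i hi).2.2 U hsub1 (by
          intro a ha
          have := hsub2 ha
          simp only [Finset.mem_sdiff, Finset.mem_singleton] at this
          simp [Input.sub, this.1, this.2]) (by rw [← g6]; exact heven)
        rw [← g5] at hI'
        by_cases hn : cut U ∈ I.narrow x ∪ I.B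
        · exact Or.inl (hI'.2 ⟨hn, U, rfl, hsub1, hsub2⟩)
        · exact Or.inr ⟨hI'.1, hn⟩
    have hnarrow : cut U ∉ I.narrow x → 2 ≤ weight x (cut U) := fun hn =>
      not_lt.1 fun hlt => hn ⟨U, h1, h2, rfl, hlt⟩
    have hd : 0 ≤ coeff k l - coeff k (l + 1) := by linarith
    refine ⟨?_, fun hB => ?_⟩
    -- With `x ≥ 1` and `y' ≥ 3`: `(λ_l - λ_{l+1}) + 3λ_{l+1} = 2λ_l - λ_k`. With `x ≥ 2`: `2(λ_l -
    -- λ_{l+1}) + (2λ_{l+1} - λ_k)`, the same value.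
    · rcases hkey with h3 | ⟨h3, h4⟩
      · nlinarith
      · have := hnarrow fun h => h4 (Or.inl h)
        nlinarith
    · have h5 := hx.1.busy _ hB
      rcases hkey with h3 | ⟨-, h4⟩
      · nlinarith
      · exact absurd (Or.inr hB) h4

end PathTSP

namespace PathTSP

variable {V : Type*} [Fintype V] [DecidableEq V] [MetricSpace V]

/-! ### Costs of vectors and edge sets. -/

section Cost

theorem edgeCost_mk (u v : V) : edgeCost s(u, v) = dist u v := rfl

theorem edgeCost_nonneg (e : Sym2 V) : 0 ≤ edgeCost e := by
  induction e with | _ u v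
  exact dist_nonneg

theorem edgeCost_pos {e : Sym2 V} (h : ¬ e.IsDiag) : 0 < edgeCost e := by
  induction e with | _ u v
  exact dist_pos.2 fun h' => h (Sym2.mk_isDiag_iff.2 h')

theorem vecCost_add (x y : Sym2 V → ℝ) : vecCost (x + y) = vecCost x + vecCost y := by
  simp [vecCost, mul_add, Finset.sum_add_distrib]

theorem vecCost_smul (r : ℝ) (x : Sym2 V → ℝ) : vecCost (r • x) = r * vecCost x := by
  simp only [vecCost, Finset.mul_sum, Pi.smul_apply, smul_eq_mul]
  exact Finset.sum_congr rfl fun e _ => by ring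

theorem vecCost_sum {ι : Type*} (s : Finset ι) (x : ι → Sym2 V → ℝ) :
    vecCost (∑ i ∈ s, x i) = ∑ i ∈ s, vecCost (x i) := by
  classical
  induction s using Finset.induction_on with
  | empty => simp [vecCost]
  | insert a s ha ih => rw [Finset.sum_insert ha, Finset.sum_insert ha, vecCost_add, ih]

theorem setCost_nonneg (F : Finset (Sym2 V)) : 0 ≤ setCost F :=
  Finset.sum_nonneg fun e _ => edgeCost_nonneg e

theorem vecCost_incidence_le (F : Finset (Sym2 V)) : vecCost (incidence F) ≤ setCost F := by
  simp only [vecCost, incidence, mul_ite, mul_one, mul_zero, ← Finset.sum_filter]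
  exact Finset.sum_le_sum_of_subset_of_nonneg (fun e he => (Finset.mem_filter.1 he).2)
    fun e _ _ => edgeCost_nonneg e

theorem setCost_union_le (F F' : Finset (Sym2 V)) : setCost (F ∪ F') ≤ setCost F + setCost F' := by
  rw [setCost, setCost, setCost, ← Finset.sum_union_inter]
  exact le_add_of_nonneg_right (Finset.sum_nonneg fun e _ => edgeCost_nonneg e)

theorem setCost_biUnion_le {ι : Type*} [DecidableEq ι] (s : Finset ι) (F : ι → Finset (Sym2 V)) :
    setCost (s.biUnion F) ≤ ∑ i ∈ s, setCost (F i) := by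
  induction s using Finset.induction_on with
  | empty => simp [setCost]
  | insert a s ha ih =>
    rw [Finset.biUnion_insert, Finset.sum_insert ha]
    exact (setCost_union_le _ _).trans (by gcongr)

end Cost

/-! ### Existence of outputs and of an optimum tour. -/

section Existence

theorem exists_isMinTreeOn {W : Finset V} (hW : W.Nonempty) : ∃ S, IsMinTreeOn W S := by
  classical
  obtain ⟨r, hr⟩ := hW
  have hstar : IsTreeOn W ((W.erase r).image fun v => s(r, v)) := by
    have hreach : ∀ u ∈ W, (SimpleGraph.fromEdgeSet
        (((W.erase r).image fun v => s(r, v) : Finset (Sym2 V)) : Set (Sym2 V))).Reachable r u := by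
      intro u hu
      by_cases h : u = r
      · rw [h]
      · refine SimpleGraph.Adj.reachable ((SimpleGraph.fromEdgeSet_adj _).2 ⟨?_, Ne.symm h⟩)
        exact Finset.mem_coe.2 (Finset.mem_image_of_mem _ (Finset.mem_erase.2 ⟨h, hu⟩))
    rw [isTreeOn_iff]
    refine ⟨?_, ⟨r, hr⟩, fun u hu v hv => (hreach u hu).symm.trans (hreach v hv), ?_⟩
    · intro e he
      obtain ⟨v, hv, rfl⟩ := Finset.mem_image.1 he
      exact mk_mem_edgesIn.2 ⟨hr, Finset.mem_of_mem_erase hv, (Finset.ne_of_mem_erase hv).symm⟩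
    · rw [Finset.card_image_of_injective _ (fun a b h => Sym2.congr_right.1 h),
        Finset.card_erase_add_one hr]
  obtain ⟨S, hS, hmin⟩ := Finset.exists_min_image
    (Finset.univ.filter fun S : Finset (Sym2 V) => IsTreeOn W S) setCost
    ⟨_, Finset.mem_filter.2 ⟨Finset.mem_univ _, hstar⟩⟩
  exact ⟨S, (Finset.mem_filter.1 hS).2, fun S' hS' =>
    hmin S' (Finset.mem_filter.2 ⟨Finset.mem_univ _, hS'⟩)⟩

namespace Input

variable {I : Input V}

/-- The value 3 on all of `E[W]` works, since every constrained cut contains an edge of `E[W]`; for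
busy cuts this is the edge `{s', t'}`, by `sep`. -/
theorem Valid.exists_isFeasible (hI : I.Valid) : ∃ x, I.IsFeasible x := by
  have hnn : ∀ e, 0 ≤ ((3 : ℝ) • incidence (edgesIn I.W)) e := fun e =>
    mul_nonneg (by norm_num) (Fractional.incidence_nonneg _ _)
  have key : ∀ (C : Finset (Sym2 V)) (e), e ∈ C → e ∈ edgesIn I.W →
      3 ≤ weight ((3 : ℝ) • incidence (edgesIn I.W)) C := by
    intro C e he he'
    refine le_trans ?_ (Finset.single_le_sum (fun e _ => hnn e) he)
    simp [incidence, he']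
  refine ⟨(3 : ℝ) • incidence (edgesIn I.W), ?_, ?_, ?_, fun e _ => hnn e, ?_⟩
  · rintro U ⟨u, hu⟩ hU
    have h1 := hU hu
    have h2 : I.s ∉ U := fun h => by simpa using hU h
    refine le_trans (by norm_num) (key (cut U) s(u, I.s) (mk_mem_cut.2 (Or.inl ⟨hu, h2⟩)) ?_)
    exact mk_mem_edgesIn.2 ⟨(Finset.mem_sdiff.1 h1).1, hI.s_mem, fun h => h2 (h ▸ hu)⟩
  · intro U h1 hU
    have hs : I.s ∈ U := h1 (by simp)
    have h2 : I.t ∉ U := fun h => by simpa using hU h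
    refine le_trans (by norm_num) (key (cut U) s(I.s, I.t) (mk_mem_cut.2 (Or.inl ⟨hs, h2⟩)) ?_)
    exact mk_mem_edgesIn.2 ⟨hI.s_mem, hI.t_mem, fun h => h2 (h ▸ hs)⟩
  · intro C hC
    obtain ⟨U, hs, h2, rfl⟩ := hI.sep C hC
    refine key (cut U) s(I.s, I.t) (mk_mem_cut.2 (Or.inl ⟨hs, h2⟩)) ?_
    exact mk_mem_edgesIn.2 ⟨hI.s_mem, hI.t_mem, fun h => h2 (h ▸ hs)⟩
  · intro e he
    simp [incidence, he]

theorem continuous_vecCost : Continuous (vecCost : (Sym2 V → ℝ) → ℝ) := by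
  unfold vecCost
  fun_prop

theorem isClosed_setOf_isFeasible (I : Input V) : IsClosed {x | I.IsFeasible x} := by
  have hw : ∀ C : Finset (Sym2 V), Continuous fun x : Sym2 V → ℝ => weight x C := by
    intro C
    unfold weight
    fun_prop
  have : {x | I.IsFeasible x} = {x |
      (∀ U : Finset V, U.Nonempty → U ⊆ I.W \ {I.s, I.t} → 2 ≤ weight x (cut U)) ∧
      (∀ U : Finset V, {I.s} ⊆ U → U ⊆ I.W \ {I.t} → 1 ≤ weight x (cut U)) ∧
      (∀ C ∈ I.B, 3 ≤ weight x C) ∧ (∀ e ∈ edgesIn I.W, 0 ≤ x e) ∧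
      ∀ e, e ∉ edgesIn I.W → x e = 0} := by
    ext x
    exact ⟨fun h => ⟨h.1, h.2, h.3, h.4, h.5⟩, fun h => ⟨h.1, h.2.1, h.2.2.1, h.2.2.2.1, h.2.2.2.2⟩⟩
  rw [this]
  simp only [Set.ofPred_and, Set.ofPred_forall]
  refine IsClosed.inter ?_ (IsClosed.inter ?_ (IsClosed.inter ?_ (IsClosed.inter ?_ ?_)))
  · exact isClosed_iInter fun U => isClosed_iInter fun _ => isClosed_iInter fun _ =>
      isClosed_le continuous_const (hw _)
  · exact isClosed_iInter fun U => isClosed_iInter fun _ => isClosed_iInter fun _ =>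
      isClosed_le continuous_const (hw _)
  · exact isClosed_iInter fun C => isClosed_iInter fun _ => isClosed_le continuous_const (hw _)
  · exact isClosed_iInter fun e => isClosed_iInter fun _ =>
      isClosed_le continuous_const (continuous_apply e)
  · exact isClosed_iInter fun e => isClosed_iInter fun _ =>
      isClosed_eq (continuous_apply e) continuous_const

/-- Compactness: distinct points have positive distance, so bounding the cost bounds every
coordinate of a feasible vector. -/
theorem Valid.exists_isOptimal (hI : I.Valid) : ∃ x, I.IsOptimal x := by
  obtain ⟨x₀, hx₀⟩ := hI.exists_isFeasible
  have hnn : ∀ x, I.IsFeasible x → ∀ e, 0 ≤ x e := fun x hx =>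
    (hx.fractional hI.s_mem hI.t_mem).nonneg
  have hM : 0 ≤ vecCost x₀ :=
    Finset.sum_nonneg fun e _ => mul_nonneg (edgeCost_nonneg e) (hnn x₀ hx₀ e)
  have hcomp : IsCompact ({x | I.IsFeasible x} ∩ {x | vecCost x ≤ vecCost x₀}) := by
    refine IsCompact.of_isClosed_subset
      (isCompact_univ_pi (s := fun e : Sym2 V => Set.Icc 0 (vecCost x₀ / edgeCost e))
        fun e => isCompact_Icc)
      ((isClosed_setOf_isFeasible I).inter (isClosed_le continuous_vecCost continuous_const)) ?_
    rintro x ⟨hx, hle⟩ e -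
    refine ⟨hnn x hx e, ?_⟩
    by_cases he : e ∈ edgesIn I.W
    · rw [le_div_iff₀ (edgeCost_pos (not_isDiag_of_mem_edgesIn he)), mul_comm]
      refine le_trans ?_ (Set.mem_ofPred_eq ▸ hle)
      exact Finset.single_le_sum (f := fun e => edgeCost e * x e)
        (fun e _ => mul_nonneg (edgeCost_nonneg e) (hnn x hx e))
        (edgesIn_mono (Finset.subset_univ _) he)
    · rw [hx.support e he]
      exact div_nonneg hM (edgeCost_nonneg e)
  obtain ⟨x, ⟨hx, hle⟩, hmin⟩ := hcomp.exists_isMinOn ⟨x₀, hx₀, by simp⟩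
    continuous_vecCost.continuousOn
  refine ⟨x, hx, fun z hz => ?_⟩
  by_cases h : vecCost z ≤ vecCost x₀
  · exact hmin ⟨hz, h⟩
  · exact le_trans hle (not_le.1 h).le

theorem Valid.exists_isPath (hI : I.Valid) (x : Sym2 V → ℝ) : ∃ m p, I.IsPath x m p := by
  refine ⟨0, fun j => if j = 0 then I.source else I.sink, by simp, by simp, fun j hj => ?_⟩
  obtain rfl : j = 0 := by omega
  refine ⟨I.s, I.t, by simp [nodes], by simp [nodes], by simp [source], by simp [sink], ?_, ?_, ?_⟩
  · refine (Finset.ssubset_iff_of_subset ?_).2 ⟨I.s, ?_, ?_⟩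
    · intro v hv
      simpa [sink, source] using Finset.disjoint_left.1 hI.disj hv
    · simpa [sink] using (mem_W.1 hI.s_mem).2
    · simpa [source] using (mem_W.1 hI.s_mem).1
  · simpa [sink, source, and_comm] using mem_W.1 hI.s_mem
  · simpa [sink, source, and_comm] using mem_W.1 hI.t_mem

theorem IsPath.le_card {x : Sym2 V → ℝ} {m : ℕ} {p : ℕ → Node V} (hp : I.IsPath x m p) :
    m + 1 ≤ Fintype.card V := by
  have : ∀ j ≤ m + 1, j ≤ #(p j).U := by
    intro j
    induction j with
    | zero => intro _; exact Nat.zero_le _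
    | succ j ih =>
      intro hj
      obtain ⟨w₁, v₂, h⟩ := hp.2.2 j (by omega)
      have := Finset.card_lt_card h.2.2.2.2.1
      have := ih (by omega)
      omega
  exact (this (m + 1) le_rfl).trans (Finset.card_le_univ _)

theorem pathCost_congr (lam : ℝ) (out : Node V → Node V → Output V) {m : ℕ} {p q : ℕ → Node V}
    (h : ∀ j ≤ m + 1, p j = q j) : pathCost lam out m p = pathCost lam out m q := by
  refine Finset.sum_congr rfl fun j hj => ?_
  have := Finset.mem_range.1 hj
  rw [h j (by omega), h (j + 1) (by omega)]

instance : Finite (Node V) :=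
  Finite.of_injective (β := Finset V × Option V × Option V) (fun a => (a.U, a.v, a.w)) fun a b h => by
    cases a
    cases b
    simpa using h

/-- The sets grow strictly along a path, so `m < |V|`, and the cost depends only on the first `m +
2` nodes. Hence only finitely many costs occur, although paths are functions on all of `ℕ`. -/
theorem Valid.exists_shortest_path (hI : I.Valid) (x : Sym2 V → ℝ) (lam : ℝ)
    (out : Node V → Node V → Output V) : ∃ m p, I.IsPath x m p ∧
      ∀ m' p', I.IsPath x m' p' → pathCost lam out m p ≤ pathCost lam out m' p' := by
  set R : Set ℝ := {r | ∃ m p, I.IsPath x m p ∧ pathCost lam out m p = r} with hR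
  have hfin : R.Finite := by
    refine (Set.finite_range fun a : Fin (Fintype.card V + 1) ×
      (Fin (Fintype.card V + 2) → Node V) => pathCost lam out a.1
        fun i => if h : i < Fintype.card V + 2 then a.2 ⟨i, h⟩ else I.source).subset ?_
    rintro r ⟨m, p, hp, rfl⟩
    have := hp.le_card
    refine ⟨(⟨m, by omega⟩, fun i => p i), pathCost_congr _ _ fun j hj => ?_⟩
    dsimp only at hj ⊢
    rw [dif_pos (by omega)]
  obtain ⟨m₀, p₀, hp₀⟩ := hI.exists_isPath x
  obtain ⟨r, ⟨m, p, hp, rfl⟩, hmin⟩ := Set.exists_min_image R id hfin ⟨_, m₀, p₀, hp₀, rfl⟩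
  exact ⟨m, p, hp, fun m' p' hp' => hmin _ ⟨m', p', hp', rfl⟩⟩

theorem Valid.exists_returns {k : ℕ} (n : ℕ) : ∀ (l : ℕ) (I : Input V), l + n = k → I.Valid →
    ∃ o, Returns k l I o := by
  induction n with
  | zero =>
    rintro l I rfl hI
    obtain ⟨x, hx⟩ := hI.exists_isOptimal
    obtain ⟨S, hS⟩ := exists_isMinTreeOn ⟨I.s, hI.s_mem⟩
    exact ⟨_, Returns.final I x S hx hS⟩
  | succ n ih =>
    intro l I hl hI
    obtain ⟨x, hx⟩ := hI.exists_isOptimal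
    -- The nodes determine `w₁` and `v₂`, so one output per pair suffices; pairs that are not arcs
    -- receive a dummy.
    have hex : ∀ a b : Node V, ∃ o, ∀ w₁ v₂, I.IsArc x a b w₁ v₂ →
        Returns k (l + 1) (I.sub x a.U w₁ b.U v₂) o := by
      intro a b
      by_cases h : ∃ w₁ v₂, I.IsArc x a b w₁ v₂
      · obtain ⟨w₁, v₂, h⟩ := h
        obtain ⟨o, ho⟩ := ih (l + 1) (I.sub x a.U w₁ b.U v₂) (by omega) h.valid
        refine ⟨o, fun w₁' v₂' h' => ?_⟩
        obtain rfl : w₁' = w₁ := Option.some.inj (h'.2.2.1.symm.trans h.2.2.1)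
        obtain rfl : v₂' = v₂ := Option.some.inj (h'.2.2.2.1.symm.trans h.2.2.2.1)
        exact ho
      · exact ⟨⟨∅, 0, ∅⟩, fun w₁ v₂ h' => absurd ⟨w₁, v₂, h'⟩ h⟩
    choose out hout using hex
    obtain ⟨m, p, hp, hmin⟩ := hI.exists_shortest_path x (coeff k (l + 1)) out
    exact ⟨_, Returns.step l (by omega) I x hx out hout m p hp hmin⟩

end Input

theorem exists_path_support (A : Finset V) : ∀ s t : V, s ∉ A → t ∉ A → s ≠ t →
    ∃ p : (⊤ : SimpleGraph V).Walk s t, p.IsPath ∧ ∀ v, v ∈ p.support ↔ v = s ∨ v = t ∨ v ∈ A := by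
  induction A using Finset.induction_on with
  | empty =>
    intro s t _ _ hst
    have hadj : (⊤ : SimpleGraph V).Adj s t := hst
    refine ⟨SimpleGraph.Walk.cons hadj SimpleGraph.Walk.nil, ?_, ?_⟩
    · simp [SimpleGraph.Walk.cons_isPath_iff, hst]
    · simp
  | insert a A ha ih =>
    intro s t hs ht hst
    simp only [Finset.mem_insert, not_or] at hs ht
    obtain ⟨p, hp, hsupp⟩ := ih a t ha ht.2 (Ne.symm ht.1)
    have hadj : (⊤ : SimpleGraph V).Adj s a := hs.1
    refine ⟨SimpleGraph.Walk.cons hadj p, ?_, ?_⟩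
    · rw [SimpleGraph.Walk.cons_isPath_iff, hsupp]
      exact ⟨hp, by tauto⟩
    · intro v
      simp only [SimpleGraph.Walk.support_cons, List.mem_cons, hsupp, Finset.mem_insert]
      tauto

theorem exists_isTour {s t : V} (hst : s ≠ t) : ∃ H, IsTour s t H := by
  obtain ⟨p, hp, hsupp⟩ := exists_path_support (Finset.univ \ {s, t}) s t (by simp) (by simp) hst
  refine ⟨_, p, hp.isHamiltonian_of_mem fun v => (hsupp v).2 ?_, rfl⟩
  simp only [Finset.mem_sdiff, Finset.mem_univ, true_and, Finset.mem_insert, Finset.mem_singleton]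
  tauto

theorem exists_isLeast_tour {s t : V} (hst : s ≠ t) :
    ∃ OPT : ℝ, IsLeast {r : ℝ | ∃ H : Finset (Sym2 V), IsTour s t H ∧ r = setCost H} OPT := by
  have hfin : {r : ℝ | ∃ H : Finset (Sym2 V), IsTour s t H ∧ r = setCost H}.Finite :=
    (Set.finite_range (setCost : Finset (Sym2 V) → ℝ)).subset fun r ⟨H, _, h⟩ => ⟨H, h.symm⟩
  obtain ⟨H, hH⟩ := exists_isTour hst
  obtain ⟨r, hr, hmin⟩ := Set.exists_min_image _ id hfin ⟨_, H, hH, rfl⟩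
  exact ⟨r, hr, fun b hb => hmin b hb⟩

end Existence

end PathTSP

namespace PathTSP

variable {V : Type*} [Fintype V] [DecidableEq V]

/-! ### Tours, lonely edges and the cost bound. -/

theorem exists_step_down {P : ℕ → Prop} {u v : ℕ} (huv : u ≤ v) (hu : P u) (hv : ¬ P v) :
    ∃ i, u ≤ i ∧ i < v ∧ P i ∧ ¬ P (i + 1) := by
  induction v, huv using Nat.le_induction with
  | base => exact absurd hu hv
  | succ n hn ih =>
    by_cases h : P n
    · exact ⟨n, hn, by omega, h, hv⟩
    · obtain ⟨i, h1, h2, h3⟩ := ih h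
      exact ⟨i, h1, by omega, h3⟩

theorem exists_step_up {P : ℕ → Prop} {u v : ℕ} (huv : u ≤ v) (hu : ¬ P u) (hv : P v) :
    ∃ i, u ≤ i ∧ i < v ∧ ¬ P i ∧ P (i + 1) := by
  obtain ⟨i, h1, h2, h3, h4⟩ := exists_step_down (P := fun i => ¬ P i) huv hu (not_not.2 hv)
  exact ⟨i, h1, h2, h3, not_not.1 h4⟩

/-- A set that contains the first but not the last of the vertices `h u, …, h v` is entered or
left at least three times, or it contains exactly an initial segment of them. -/
theorem three_le_card_or_initial (h : ℕ → V) (U : Finset V) {u v : ℕ} (huv : u ≤ v)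
    (hu : h u ∈ U) (hv : h v ∉ U) :
    3 ≤ #((Finset.Ico u v).filter fun i => s(h i, h (i + 1)) ∈ cut U) ∨
    ∃ i, u ≤ i ∧ i < v ∧ ∀ j, u ≤ j → j ≤ v → (h j ∈ U ↔ j ≤ i) := by
  classical
  have hex : ∃ i, u ≤ i ∧ i ≤ v ∧ h i ∉ U := ⟨v, huv, le_rfl, hv⟩
  obtain ⟨hn1, hn2, hn3⟩ := Nat.find_spec hex
  have hmin := fun m hm => Nat.find_min hex (m := m) hm
  set n := Nat.find hex
  have hlt : u < n := lt_of_le_of_ne hn1 fun h => hn3 (h ▸ hu)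
  have hbelow : ∀ j, u ≤ j → j < n → h j ∈ U := fun j h1 h2 =>
    by_contra fun hj => hmin j h2 ⟨h1, by omega, hj⟩
  by_cases hagain : ∃ j, n ≤ j ∧ j ≤ v ∧ h j ∈ U
  · left
    obtain ⟨j, hj1, hj2, hj3⟩ := hagain
    obtain ⟨b, b1, b2, b3, b4⟩ := exists_step_up (P := fun i => h i ∈ U) hj1 hn3 hj3
    obtain ⟨c, c1, c2, c3, c4⟩ := exists_step_down (P := fun i => h i ∈ U) hj2 hj3 hv
    -- The sequence first leaves `U` at step `n - 1`, re-enters at `b` and leaves again at `c`.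
    have hsub : ({n - 1, b, c} : Finset ℕ) ⊆
        (Finset.Ico u v).filter fun i => s(h i, h (i + 1)) ∈ cut U := by
      intro i hi
      simp only [Finset.mem_insert, Finset.mem_singleton] at hi
      rw [Finset.mem_filter, Finset.mem_Ico, mk_mem_cut]
      rcases hi with rfl | rfl | rfl
      · refine ⟨⟨by omega, by omega⟩, Or.inl ⟨hbelow _ (by omega) (by omega), ?_⟩⟩
        rwa [Nat.sub_add_cancel (by omega)]
      · exact ⟨⟨by omega, by omega⟩, Or.inr ⟨b4, b3⟩⟩
      · exact ⟨⟨by omega, by omega⟩, Or.inl ⟨c3, c4⟩⟩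
    refine le_trans (le_of_eq ?_) (Finset.card_le_card hsub)
    rw [Finset.card_eq_three.2 ⟨n - 1, b, c, by omega, by omega, by omega, rfl⟩]
  · right
    refine ⟨n - 1, by omega, by omega, fun j h1 h2 => ⟨fun hj => ?_, fun hj => ?_⟩⟩
    · by_contra hlt'
      exact hagain ⟨j, by omega, h2, hj⟩
    · exact hbelow j h1 (by omega)

/-- The edges `{h i, h (i + 1)}` with `a < i < b`. -/
def tourEdges (h : ℕ → V) (a b : ℕ) : Finset (Sym2 V) :=
  (Finset.Ico (a + 1) b).image fun i => s(h i, h (i + 1))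

/-- The set `W_s ∪ {h (a + 1), …, h i}`. -/
def initialSet (I : Input V) (h : ℕ → V) (a i : ℕ) : Finset V :=
  I.Ws ∪ (Finset.Icc (a + 1) i).image h

/-- The node of the auxiliary digraph for the `i`-th edge of a tour; the source for `i = a` and
the sink for `i = b`. -/
def tourNode (I : Input V) (h : ℕ → V) (a b i : ℕ) : Node V where
  U := initialSet I h a i
  v := if i = a then none else some (h i)
  w := if i = b then none else some (h (i + 1))

/-- The length of the part `h (a + 1), …, h b` of a tour. -/
noncomputable def tourLength [MetricSpace V] (h : ℕ → V) (a b : ℕ) : ℝ :=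
  ∑ i ∈ Finset.Ico (a + 1) b, dist (h i) (h (i + 1))

/-- `h (a + 1), …, h b` are the vertices of a tour for the input `I`, and this tour has at least
three edges in every busy cut. -/
structure TourOn (h : ℕ → V) (a b : ℕ) (I : Input V) : Prop where
  lt : a < b
  inj : Set.InjOn h (Set.Icc (a + 1) b)
  image : (Finset.Icc (a + 1) b).image h = I.W
  start : h (a + 1) = I.s
  last : h b = I.t
  busy : ∀ C ∈ I.B, 3 ≤ #((Finset.Ico (a + 1) b).filter fun i => s(h i, h (i + 1)) ∈ C)

namespace TourOn

variable {h : ℕ → V} {a b : ℕ} {I : Input V}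

theorem injOn_edges (H : TourOn h a b I) :
    Set.InjOn (fun i => s(h i, h (i + 1))) (Finset.Ico (a + 1) b : Finset ℕ) := by
  intro i hi j hj hij
  have hi' := Finset.mem_Ico.1 (Finset.mem_coe.1 hi)
  have hj' := Finset.mem_Ico.1 (Finset.mem_coe.1 hj)
  rcases Sym2.eq_iff.1 hij with ⟨h1, -⟩ | ⟨h1, h2⟩
  · exact H.inj ⟨by omega, by omega⟩ ⟨by omega, by omega⟩ h1
  · have e1 := H.inj ⟨by omega, by omega⟩ ⟨by omega, by omega⟩ h1
    have e2 := H.inj ⟨by omega, by omega⟩ ⟨by omega, by omega⟩ h2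
    omega

theorem card_inter (H : TourOn h a b I) (C : Finset (Sym2 V)) :
    #(tourEdges h a b ∩ C) = #((Finset.Ico (a + 1) b).filter fun i => s(h i, h (i + 1)) ∈ C) := by
  rw [← Finset.filter_mem_eq_inter, tourEdges, Finset.filter_image, Finset.card_image_of_injOn]
  exact H.injOn_edges.mono (Finset.coe_subset.2 (Finset.filter_subset _ _))

theorem mem_W (H : TourOn h a b I) {i : ℕ} (h1 : a < i) (h2 : i ≤ b) : h i ∈ I.W := by
  rw [← H.image]
  exact Finset.mem_image_of_mem _ (Finset.mem_Icc.2 ⟨h1, h2⟩)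

theorem edges_subset (H : TourOn h a b I) : tourEdges h a b ⊆ edgesIn I.W := by
  intro e he
  obtain ⟨i, hi, rfl⟩ := Finset.mem_image.1 he
  rw [Finset.mem_Ico] at hi
  refine mk_mem_edgesIn.2 ⟨H.mem_W (by omega) (by omega), H.mem_W (by omega) (by omega), fun hh => ?_⟩
  have := H.inj ⟨by omega, by omega⟩ ⟨by omega, by omega⟩ hh
  omega

theorem isTreeOn (H : TourOn h a b I) : IsTreeOn I.W (tourEdges h a b) := by
  have hlt := H.lt
  have hreach : ∀ i, a + 1 ≤ i → i ≤ b → (SimpleGraph.fromEdgeSet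
      (tourEdges h a b : Set (Sym2 V))).Reachable (h (a + 1)) (h i) := by
    intro i h1
    induction i, h1 using Nat.le_induction with
    | base => intro _; exact SimpleGraph.Reachable.refl _
    | succ n hn ih =>
      intro h2
      have hmem : s(h n, h (n + 1)) ∈ tourEdges h a b :=
        Finset.mem_image_of_mem (fun i => s(h i, h (i + 1))) (Finset.mem_Ico.2 ⟨hn, by omega⟩)
      refine (ih (by omega)).trans (SimpleGraph.Adj.reachable ((SimpleGraph.fromEdgeSet_adj _).2
        ⟨Finset.mem_coe.2 hmem, (mk_mem_edgesIn.1 (H.edges_subset hmem)).2.2⟩))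
  have hreach' : ∀ v ∈ I.W, (SimpleGraph.fromEdgeSet
      (tourEdges h a b : Set (Sym2 V))).Reachable (h (a + 1)) v := by
    intro v hv
    rw [← H.image] at hv
    obtain ⟨i, hi, rfl⟩ := Finset.mem_image.1 hv
    exact hreach i (Finset.mem_Icc.1 hi).1 (Finset.mem_Icc.1 hi).2
  rw [isTreeOn_iff]
  refine ⟨H.edges_subset, ⟨_, H.mem_W (i := b) hlt le_rfl⟩,
    fun u hu v hv => (hreach' u hu).symm.trans (hreach' v hv), ?_⟩
  rw [tourEdges, Finset.card_image_of_injOn H.injOn_edges, ← H.image,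
    Finset.card_image_of_injOn (by simpa using H.inj), Nat.card_Ico, Nat.card_Icc]
  omega

/-- A tour must both enter and leave a set avoiding its ends, and must leave a set containing only
its start. -/
theorem isFeasible (H : TourOn h a b I) : I.IsFeasible (incidence (tourEdges h a b)) := by
  have hlt := H.lt
  refine ⟨?_, ?_, ?_, fun e _ => Fractional.incidence_nonneg _ _, ?_⟩
  · rintro U ⟨u, hu⟩ hU
    rw [weight_incidence, H.card_inter]
    have hs : h (a + 1) ∉ U := fun hh => by
      have := hU hh
      simp [H.start] at this
    have ht : h b ∉ U := fun hh => by
      have := hU hh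
      simp [H.last] at this
    have huW := (Finset.mem_sdiff.1 (hU hu)).1
    rw [← H.image] at huW
    obtain ⟨j, hj, rfl⟩ := Finset.mem_image.1 huW
    rw [Finset.mem_Icc] at hj
    obtain ⟨c, c1, c2, c3, c4⟩ := exists_step_up (P := fun i => h i ∈ U) hj.1 hs hu
    obtain ⟨d, d1, d2, d3, d4⟩ := exists_step_down (P := fun i => h i ∈ U) hj.2 hu ht
    have : 1 < #((Finset.Ico (a + 1) b).filter fun i => s(h i, h (i + 1)) ∈ cut U) := by
      refine Finset.one_lt_card.2 ⟨c, ?_, d, ?_, by omega⟩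
      · rw [Finset.mem_filter, Finset.mem_Ico, mk_mem_cut]
        exact ⟨⟨by omega, by omega⟩, Or.inr ⟨c4, c3⟩⟩
      · rw [Finset.mem_filter, Finset.mem_Ico, mk_mem_cut]
        exact ⟨⟨by omega, by omega⟩, Or.inl ⟨d3, d4⟩⟩
    exact_mod_cast this
  · intro U h1 hU
    rw [weight_incidence, H.card_inter]
    have hs : h (a + 1) ∈ U := by
      rw [H.start]
      exact h1 (by simp)
    have ht : h b ∉ U := fun hh => by
      have := hU hh
      simp [H.last] at this
    obtain ⟨d, d1, d2, d3, d4⟩ := exists_step_down (P := fun i => h i ∈ U) hlt hs ht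
    have : 0 < #((Finset.Ico (a + 1) b).filter fun i => s(h i, h (i + 1)) ∈ cut U) := by
      refine Finset.card_pos.2 ⟨d, ?_⟩
      rw [Finset.mem_filter, Finset.mem_Ico, mk_mem_cut]
      exact ⟨⟨by omega, by omega⟩, Or.inl ⟨d3, d4⟩⟩
    exact_mod_cast this
  · intro C hC
    rw [weight_incidence, H.card_inter]
    exact_mod_cast H.busy C hC
  · intro e he
    have : e ∉ tourEdges h a b := fun hh => he (H.edges_subset hh)
    simp [incidence, this]

theorem mem_initialSet (H : TourOn h a b I) {i j : ℕ} (h1 : a < j) (h2 : j ≤ b) (hi : i ≤ b) :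
    h j ∈ initialSet I h a i ↔ j ≤ i := by
  have hW := Input.mem_W.1 (H.mem_W h1 h2)
  simp only [initialSet, Finset.mem_union, hW.1, false_or, Finset.mem_image, Finset.mem_Icc]
  constructor
  · rintro ⟨l, hl, hlj⟩
    have := H.inj ⟨by omega, by omega⟩ ⟨by omega, by omega⟩ hlj
    omega
  · exact fun hj => ⟨j, ⟨h1, hj⟩, rfl⟩

theorem initialSet_mono {i j : ℕ} (hij : i ≤ j) : initialSet I h a i ⊆ initialSet I h a j :=
  Finset.union_subset_union_right
    (Finset.image_subset_image (Finset.Icc_subset_Icc_right hij))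

theorem initialSet_self : initialSet I h a a = I.Ws := by
  simp [initialSet]

theorem initialSet_end (H : TourOn h a b I) (hI : I.Valid) :
    initialSet I h a b = Finset.univ \ I.Wt := by
  rw [initialSet, H.image]
  ext v
  have : v ∈ I.Ws → v ∉ I.Wt := fun hv => Finset.disjoint_left.1 hI.disj hv
  simp only [Finset.mem_union, Input.mem_W, Finset.mem_sdiff, Finset.mem_univ, true_and]
  tauto

/-- A part of a tour between two consecutive lonely edges is a tour for the sub-instance. -/
theorem sub (H : TourOn h a b I) {x : Sym2 V → ℝ} {u v : ℕ} (hau : a ≤ u) (huv : u < v)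
    (hvb : v ≤ b)
    (hno : ∀ i, u < i → i < v → 2 ≤ weight x (cut (initialSet I h a i))) :
    TourOn h u v
      (I.sub x (initialSet I h a u) (h (u + 1)) (initialSet I h a v) (h v)) where
  lt := huv
  inj := H.inj.mono (Set.Icc_subset_Icc (by omega) hvb)
  image := by
    rw [Input.sub_W]
    ext z
    constructor
    · intro hz
      obtain ⟨j, hj, rfl⟩ := Finset.mem_image.1 hz
      rw [Finset.mem_Icc] at hj
      rw [Finset.mem_sdiff, H.mem_initialSet (by omega) (by omega) hvb,
        H.mem_initialSet (by omega) (by omega) (by omega)]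
      omega
    · intro hz
      obtain ⟨h1, h2⟩ := Finset.mem_sdiff.1 hz
      rcases Finset.mem_union.1 h1 with h1 | h1
      · exact absurd (Finset.mem_union_left _ h1) h2
      · obtain ⟨j, hj, rfl⟩ := Finset.mem_image.1 h1
        rw [Finset.mem_Icc] at hj
        rw [H.mem_initialSet (by omega) (by omega) (by omega)] at h2
        exact Finset.mem_image_of_mem _ (Finset.mem_Icc.2 ⟨by omega, hj.2⟩)
  start := rfl
  last := rfl
  busy := by
    rintro C ⟨hC, U, rfl, hU1, hU2⟩
    have hlow : ∀ j, a < j → j ≤ u + 1 → h j ∈ U := by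
      intro j h1 h2
      rcases Nat.lt_or_ge u j with h3 | h3
      · obtain rfl : j = u + 1 := by omega
        exact hU1 (by simp)
      · exact hU1 (Finset.mem_union_left _ ((H.mem_initialSet h1 (by omega) (by omega)).2 h3))
    have hhigh : ∀ j, v ≤ j → j ≤ b → h j ∉ U := by
      intro j h1 h2 hj
      have h3 := Finset.mem_sdiff.1 (hU2 hj)
      have h4 := (H.mem_initialSet (by omega) h2 hvb).1 h3.1
      obtain rfl : j = v := by omega
      simp at h3
    -- A narrow cut crossed fewer than three times would come from an initial set strictly between
    -- `u` and `v`, which `hno` excludes. For an inherited busy cut, `hlow` and `hhigh` place all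
    -- its tour edges within this part.
    rcases hC with ⟨-, -, -, -, hC⟩ | hC
    · rcases three_le_card_or_initial h U (show u + 1 ≤ v from huv)
        (hlow _ (by omega) le_rfl) (hhigh v le_rfl hvb) with h3 | ⟨i, h1, h2, h3⟩
      · exact h3
      · have hUi : U = initialSet I h a i := by
          ext z
          constructor
          · intro hz
            have h4 := (Finset.mem_sdiff.1 (hU2 hz)).1
            rcases Finset.mem_union.1 h4 with h4 | h4
            · exact Finset.mem_union_left _ h4
            · obtain ⟨j, hj, rfl⟩ := Finset.mem_image.1 h4
              rw [Finset.mem_Icc] at hj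
              rw [H.mem_initialSet (by omega) (by omega) (by omega)]
              rcases Nat.lt_or_ge u j with h5 | h5
              · exact (h3 j h5 hj.2).1 hz
              · omega
          · intro hz
            rcases Finset.mem_union.1 hz with h4 | h4
            · exact hU1 (Finset.mem_union_left _ (Finset.mem_union_left _ h4))
            · obtain ⟨j, hj, rfl⟩ := Finset.mem_image.1 h4
              rw [Finset.mem_Icc] at hj
              rcases Nat.lt_or_ge u j with h5 | h5
              · exact (h3 j h5 (by omega)).2 hj.2
              · exact hlow j (by omega) (by omega)
        have := hno i (by omega) h2
        rw [← hUi] at this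
        linarith
    · refine (H.busy _ hC).trans (Finset.card_le_card fun i hi => ?_)
      rw [Finset.mem_filter, Finset.mem_Ico] at hi ⊢
      obtain ⟨h1, h2⟩ := hi
      refine ⟨?_, h2⟩
      rw [mk_mem_cut] at h2
      constructor
      · by_contra hlt
        have := hlow i (by omega) (by omega)
        have := hlow (i + 1) (by omega) (by omega)
        tauto
      · by_contra hlt
        have := hhigh i (by omega) (by omega)
        have := hhigh (i + 1) (by omega) (by omega)
        tauto

theorem tourNode_start (H : TourOn h a b I) : tourNode I h a b a = I.source := by
  simp [tourNode, Input.source, initialSet_self, H.lt.ne, H.start]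

theorem tourNode_end (H : TourOn h a b I) (hI : I.Valid) : tourNode I h a b b = I.sink := by
  simp [tourNode, Input.sink, H.initialSet_end hI, H.lt.ne', H.last]

theorem tourNode_mem (H : TourOn h a b I) (hI : I.Valid) {x : Sym2 V → ℝ} {i : ℕ} (h1 : a ≤ i)
    (h2 : i ≤ b) (h3 : i = a ∨ i = b ∨ weight x (cut (initialSet I h a i)) < 2) :
    tourNode I h a b i ∈ I.nodes x := by
  by_cases ha : i = a
  · subst ha
    rw [H.tourNode_start]
    simp [Input.nodes]
  by_cases hb : i = b
  · subst hb
    rw [H.tourNode_end hI]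
    simp [Input.nodes]
  have hw : weight x (cut (initialSet I h a i)) < 2 := by tauto
  have hs : I.s ∈ initialSet I h a i := by
    rw [← H.start, H.mem_initialSet (by omega) (by omega) h2]
    omega
  refine Or.inl ⟨⟨initialSet I h a i, ?_, ?_, rfl, hw⟩, hs, ⟨h i, ?_, by simp [tourNode, ha]⟩,
    ⟨h (i + 1), ?_, by simp [tourNode, hb]⟩⟩
  · exact Finset.union_subset Finset.subset_union_left (by simpa using hs)
  · intro z hz
    have h4 := initialSet_mono h2 hz
    rw [H.initialSet_end hI] at h4
    simp only [Finset.mem_sdiff, Finset.mem_univ, true_and, Finset.mem_union,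
      Finset.mem_singleton, not_or] at h4 ⊢
    refine ⟨h4, fun h5 => ?_⟩
    rw [h5, ← H.last, H.mem_initialSet H.lt le_rfl h2] at hz
    omega
  · refine Finset.mem_inter.2 ⟨?_, H.mem_W (by omega) h2⟩
    exact (H.mem_initialSet (by omega) h2 h2).2 le_rfl
  · refine Finset.mem_sdiff.2 ⟨H.mem_W (by omega) (by omega), fun h5 => ?_⟩
    have := (H.mem_initialSet (by omega) (by omega) h2).1 h5
    omega

theorem isArc (H : TourOn h a b I) (hI : I.Valid) {x : Sym2 V → ℝ} {u v : ℕ} (hau : a ≤ u)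
    (huv : u < v) (hvb : v ≤ b)
    (hu : u = a ∨ u = b ∨ weight x (cut (initialSet I h a u)) < 2)
    (hv : v = a ∨ v = b ∨ weight x (cut (initialSet I h a v)) < 2) :
    I.IsArc x (tourNode I h a b u) (tourNode I h a b v) (h (u + 1)) (h v) := by
  have hv1 : h v ∈ initialSet I h a v \ initialSet I h a u := by
    rw [Finset.mem_sdiff, H.mem_initialSet (by omega) hvb hvb,
      H.mem_initialSet (by omega) hvb (by omega)]
    omega
  refine ⟨H.tourNode_mem hI hau (by omega) hu, H.tourNode_mem hI (by omega) hvb hv,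
    if_neg (by omega), if_neg (by omega), ?_, ?_, hv1⟩
  · exact (Finset.ssubset_iff_of_subset (initialSet_mono huv.le)).2
      ⟨h v, (Finset.mem_sdiff.1 hv1).1, (Finset.mem_sdiff.1 hv1).2⟩
  · rw [Finset.mem_sdiff]
    change h (u + 1) ∈ initialSet I h a v ∧ h (u + 1) ∉ initialSet I h a u
    rw [H.mem_initialSet (by omega) (by omega) hvb, H.mem_initialSet (by omega) (by omega) (by omega)]
    omega

variable [MetricSpace V]

theorem setCost_edges (H : TourOn h a b I) : setCost (tourEdges h a b) = tourLength h a b := by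
  rw [setCost, tourEdges, Finset.sum_image H.injOn_edges]
  rfl

/-- From `u` jump to the next index whose initial set gives a narrow cut, or to `b`. No narrow
initial cut lies strictly between, so the piece is a tour for the sub-instance and `hout` bounds its
output; the tour edge at the new index pays for the link. -/
theorem exists_path (H : TourOn h a b I) (hI : I.Valid) {x : Sym2 V → ℝ} {lam : ℝ}
    (out : Node V → Node V → Output V)
    (hout : ∀ u v w₁ v₂, I.IsArc x u v w₁ v₂ → ∀ a' b', TourOn h a' b' (I.sub x u.U w₁ v.U v₂) →
      setCost (out u v).S + lam * vecCost (out u v).y ≤ (1 + lam) * tourLength h a' b') :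
    ∀ n u, b - u = n → a ≤ u → u < b →
      (u = a ∨ u = b ∨ weight x (cut (initialSet I h a u)) < 2) →
      ∃ (m : ℕ) (p : ℕ → Node V), p 0 = tourNode I h a b u ∧ p (m + 1) = I.sink ∧
        (∀ j ≤ m, ∃ w₁ v₂, I.IsArc x (p j) (p (j + 1)) w₁ v₂) ∧
        pathCost lam out m p ≤ (1 + lam) * tourLength h u b := by
  classical
  intro n
  induction n using Nat.strong_induction_on with
  | _ n ih =>
  intro u hn hau hub hu
  have hex : ∃ v, u < v ∧ v ≤ b ∧ (v = b ∨ weight x (cut (initialSet I h a v)) < 2) :=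
    ⟨b, hub, le_rfl, Or.inl rfl⟩
  obtain ⟨h1, h2, h3⟩ := Nat.find_spec hex
  have hmin := fun m hm => Nat.find_min hex (m := m) hm
  set v := Nat.find hex
  have harc := H.isArc hI hau h1 h2 hu (Or.inr h3)
  have hno : ∀ i, u < i → i < v → 2 ≤ weight x (cut (initialSet I h a i)) := by
    intro i hi hi'
    by_contra hlt
    exact hmin i hi' ⟨hi, by omega, Or.inr (not_le.1 hlt)⟩
  have hcost := hout _ _ _ _ harc u v (H.sub hau h1 h2 hno)
  by_cases hv : v = b
  · rw [hv] at harc hcost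
    refine ⟨0, fun j => if j = 0 then tourNode I h a b u else tourNode I h a b b, by simp,
      by simpa using H.tourNode_end hI, fun j hj => ?_, ?_⟩
    · obtain rfl : j = 0 := by omega
      exact ⟨_, _, harc⟩
    · have hlink : setCost (tourNode I h a b b).link = 0 := by
        rw [H.tourNode_end hI]
        simp [Node.link, Input.sink, setCost]
      simp only [pathCost, zero_add, Finset.range_one, Finset.sum_singleton, if_true, one_ne_zero,
        if_false, arcCost, hlink, mul_zero, add_zero]
      exact hcost
  · obtain ⟨m, p, hp0, hp1, hp2, hp3⟩ := ih (b - v) (by omega) v rfl (by omega) (by omega)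
      (Or.inr h3)
    refine ⟨m + 1, fun j => Nat.casesOn j (tourNode I h a b u) p, rfl, hp1, fun j hj => ?_, ?_⟩
    · cases j with
      | zero =>
        dsimp only
        rw [hp0]
        exact ⟨_, _, harc⟩
      | succ j => exact hp2 j (by omega)
    · have hlink : setCost (tourNode I h a b v).link = dist (h v) (h (v + 1)) := by
        simp [Node.link, tourNode, hv, show v ≠ a by omega, setCost, edgeCost_mk]
      have hlen : tourLength h u b =
          tourLength h u v + dist (h v) (h (v + 1)) + tourLength h v b := by
        unfold tourLength
        rw [← Finset.sum_Ico_succ_top h1, Finset.sum_Ico_consecutive _ (by omega) (by omega)]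
      rw [pathCost, Finset.sum_range_succ']
      change (∑ j ∈ Finset.range (m + 1), arcCost lam (p (j + 1)) (out (p j) (p (j + 1)))) +
        arcCost lam (p 0) (out (tourNode I h a b u) (p 0)) ≤ _
      rw [hp0, arcCost, hlink, hlen]
      rw [pathCost] at hp3
      linarith

end TourOn

/-- The sequence `h` stays fixed through the recursion; sub-instances only see shorter index
intervals. -/
theorem Returns.cost_le [MetricSpace V] {k l : ℕ} (hk : 1 ≤ k) {I : Input V} {o : Output V}
    (hr : Returns k l I o) (hI : I.Valid) (h : ℕ → V) :
    ∀ a b, TourOn h a b I →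
      setCost o.S + coeff k l * vecCost o.y ≤ (1 + coeff k l) * tourLength h a b := by
  induction hr with
  | final I x S hx hS =>
    intro a b H
    have h1 := hS.2 _ H.isTreeOn
    have h2 := (hx.2 _ H.isFeasible).trans (vecCost_incidence_le _)
    rw [H.setCost_edges] at h1 h2
    have := mul_le_mul_of_nonneg_left h2 (coeff_pos hk k).le
    dsimp only
    linarith
  | step l hl I x hx out hout m p hp hmin ih =>
    intro a b H
    have hc := coeff_pos hk l
    have hc' := coeff_pos hk (l + 1)
    have hck := coeff_pos hk k
    have hceq := coeff_eq hl
    obtain ⟨m', p', hp0, hp1, hp2, hp3⟩ := H.exists_path hI (lam := coeff k (l + 1)) out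
      (fun u v w₁ v₂ harc => ih u v w₁ v₂ harc harc.valid) _ a rfl le_rfl H.lt (Or.inl rfl)
    have hle := (hmin m' p' ⟨hp0.trans H.tourNode_start, hp1, hp2⟩).trans hp3
    have h2 := (hx.2 _ H.isFeasible).trans (vecCost_incidence_le _)
    rw [H.setCost_edges] at h2
    have hlink₀ : (p 0).link = ∅ := by rw [hp.1]; rfl
    have hlinkm : (p (m + 1)).link = ∅ := by rw [hp.2.1]; rfl
    have hlinks : ∑ j ∈ Finset.range (m + 1), setCost (p (j + 1)).link =
        ∑ j ∈ Finset.Icc 1 m, setCost (p j).link := by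
      rw [Finset.sum_range_succ, hlinkm, Finset.range_eq_Ico,
        Finset.sum_Ico_add' (fun j => setCost (p j).link) 0 m 1, zero_add,
        Finset.Ico_add_one_right_eq_Icc]
      simp [setCost]
    have hS : setCost (pathTree out m p) ≤
        ∑ j ∈ Finset.range (m + 1), setCost (out (p j) (p (j + 1))).S +
          ∑ j ∈ Finset.range (m + 1), setCost (p (j + 1)).link := by
      refine (setCost_union_le _ _).trans (add_le_add (setCost_biUnion_le _ _) ?_)
      refine (setCost_biUnion_le _ _).trans ?_
      rw [Finset.sum_range_succ', hlink₀]
      simp [setCost]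
    have hy : vecCost (pathVec out m p) ≤
        ∑ j ∈ Finset.range (m + 1), vecCost (out (p j) (p (j + 1))).y +
          ∑ j ∈ Finset.range (m + 1), setCost (p (j + 1)).link := by
      rw [pathVec, vecCost_add, vecCost_sum, vecCost_sum, hlinks]
      exact add_le_add le_rfl (Finset.sum_le_sum fun j _ => vecCost_incidence_le _)
    have hpc : pathCost (coeff k (l + 1)) out m p =
        ∑ j ∈ Finset.range (m + 1), setCost (out (p j) (p (j + 1))).S +
        coeff k (l + 1) * ∑ j ∈ Finset.range (m + 1), vecCost (out (p j) (p (j + 1))).y +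
        (1 + coeff k (l + 1)) * ∑ j ∈ Finset.range (m + 1), setCost (p (j + 1)).link := by
      simp only [pathCost, arcCost, Finset.sum_add_distrib, ← Finset.mul_sum]
    dsimp only
    rw [vecCost_add, vecCost_smul, vecCost_smul]
    have hmul : coeff k l * ((coeff k l - coeff k (l + 1)) / coeff k l * vecCost x +
        coeff k (l + 1) / coeff k l * vecCost (pathVec out m p)) =
        (coeff k l - coeff k (l + 1)) * vecCost x +
          coeff k (l + 1) * vecCost (pathVec out m p) := by
      field_simp
    rw [hmul]
    -- The LP part costs at most `(λ_l - λ_{l+1}) c(H)` and the path at most `(1 + λ_{l+1}) c(H)`,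
    -- which add up to `(1 + λ_l) c(H)`.
    have h3 := mul_le_mul_of_nonneg_left h2 (show 0 ≤ coeff k l - coeff k (l + 1) by linarith)
    have h4 := mul_le_mul_of_nonneg_left hy hc'.le
    linarith

end PathTSP

namespace PathTSP

variable {V : Type*} [Fintype V] [DecidableEq V]

/-! ### Parity of cuts and wrong-parity vertices. -/

section Parity

theorem odd_card_filter_mem_cut_iff {e : Sym2 V} (he : ¬ e.IsDiag) (U : Finset V) :
    Odd #(U.filter fun v => e ∈ cut {v}) ↔ e ∈ cut U := by
  induction e with | _ a b
  have hab : a ≠ b := fun h => he (Sym2.mk_isDiag_iff.2 h)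
  have hfilter : (U.filter fun v => s(a, b) ∈ cut {v}) = U.filter fun v => v = a ∨ v = b := by
    refine Finset.filter_congr fun v _ => ?_
    simp only [mk_mem_cut, Finset.mem_singleton]
    constructor
    · rintro (⟨h, -⟩ | ⟨h, -⟩) <;> simp [h]
    · rintro (rfl | rfl)
      · simp [hab.symm]
      · simp [hab]
  rw [hfilter, Finset.filter_or, Finset.filter_eq', Finset.filter_eq', mk_mem_cut]
  by_cases ha : a ∈ U <;> by_cases hb : b ∈ U <;> simp [ha, hb, hab]

/-- Handshake argument: summing degrees over `U` counts each edge by its endpoints in `U`, an odd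
number only for edges of the cut. -/
theorem odd_sum_degree_iff {S : Finset (Sym2 V)} (hS : ∀ e ∈ S, ¬ e.IsDiag) (U : Finset V) :
    Odd (∑ v ∈ U, #(cut {v} ∩ S)) ↔ Odd #(S ∩ cut U) := by
  have h : ∑ v ∈ U, #(cut {v} ∩ S) = ∑ e ∈ S, #(U.filter fun v => e ∈ cut {v}) := by
    refine Eq.trans ?_
      (Finset.sum_card_bipartiteAbove_eq_sum_card_bipartiteBelow fun v e => e ∈ cut {v})
    refine Finset.sum_congr rfl fun v _ => ?_
    rw [Finset.bipartiteAbove, Finset.filter_mem_eq_inter, Finset.inter_comm]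
  rw [h, Finset.odd_sum_iff_odd_card_odd,
    Finset.filter_congr fun e he => odd_card_filter_mem_cut_iff (hS e he) U,
    Finset.filter_mem_eq_inter]

theorem odd_card_symmDiff (A B : Finset V) :
    Odd #(symmDiff A B) ↔ ¬(Odd #A ↔ Odd #B) := by
  have h1 := Finset.card_sdiff_add_card_inter A B
  have h2 := Finset.card_sdiff_add_card_inter B A
  rw [Finset.inter_comm] at h2
  have h3 : #(symmDiff A B) = #(A \ B) + #(B \ A) :=
    Finset.card_union_of_disjoint disjoint_sdiff_sdiff
  simp only [Nat.odd_iff]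
  omega

theorem odd_card_inter_wrongParity {S : Finset (Sym2 V)} (hS : ∀ e ∈ S, ¬ e.IsDiag)
    (U : Finset V) (s t : V) :
    Odd #(U ∩ wrongParity S s t) ↔ (Odd #(S ∩ cut U) ↔ (s ∈ U ↔ t ∈ U)) := by
  have hmem : ∀ v : V, Odd #(U ∩ {v}) ↔ v ∈ U := by
    intro v
    by_cases h : v ∈ U <;> simp [h]
  have hD : U ∩ (Finset.univ.filter fun v => Odd #(cut {v} ∩ S)) =
      U.filter fun v => Odd #(cut {v} ∩ S) := by
    ext v
    simp
  have hdist : ∀ A B : Finset V, U ∩ symmDiff A B = symmDiff (U ∩ A) (U ∩ B) :=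
    fun A B => inf_symmDiff_distrib_left U A B
  rw [wrongParity, hdist, hdist, odd_card_symmDiff, odd_card_symmDiff, hmem, hmem, hD,
    ← Finset.odd_sum_iff_odd_card_odd, odd_sum_degree_iff hS]
  tauto

end Parity

/-! ### The top-level call. -/

section Tour

variable {s t : V}

theorem topInput_W : (topInput s t).W = Finset.univ := by
  ext v
  simp [Input.mem_W, topInput]

theorem topInput_valid : (topInput s t).Valid where
  disj := by simp [topInput]
  s_mem := by simp [topInput_W]
  t_mem := by simp [topInput_W]
  sep := fun C hC => absurd hC (Set.notMem_empty C)

theorem IsTour.exists_tourOn {H : Finset (Sym2 V)} (hH : IsTour s t H) :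
    ∃ h b, TourOn h 0 b (topInput s t) ∧ tourEdges h 0 b ⊆ H := by
  obtain ⟨p, hp, rfl⟩ := hH
  -- The shift by one is needed because a tour on `(a, b]` starts at index `a + 1`, here with `a =
  -- 0`.
  refine ⟨fun i => p.getVert (i - 1), p.length + 1, ⟨Nat.succ_pos _, ?_, ?_, ?_, ?_, ?_⟩, ?_⟩
  · intro i hi j hj hij
    have hi' := Set.mem_Icc.1 hi
    have hj' := Set.mem_Icc.1 hj
    have := hp.isPath.getVert_injOn (show i - 1 ≤ p.length by omega)
      (show j - 1 ≤ p.length by omega) hij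
    omega
  · rw [topInput_W, Finset.eq_univ_iff_forall]
    intro v
    obtain ⟨n, rfl, hn⟩ := SimpleGraph.Walk.mem_support_iff_exists_getVert.1 (hp.mem_support v)
    exact Finset.mem_image.2 ⟨n + 1, Finset.mem_Icc.2 ⟨by omega, by omega⟩, rfl⟩
  · simp [topInput]
  · simp [topInput]
  · exact fun C hC => absurd hC (Set.notMem_empty C)
  · intro e he
    obtain ⟨i, hi, rfl⟩ := Finset.mem_image.1 he
    rw [Finset.mem_Ico] at hi
    obtain ⟨j, rfl⟩ : ∃ j, i = j + 1 := ⟨i - 1, by omega⟩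
    rw [List.mem_toFinset]
    exact (p.mk_mem_edges_iff_exists).2 ⟨j, by omega, rfl⟩

end Tour

theorem coeff_one_le {ε : ℝ} (hε : 0 < ε) (hε' : ε ≤ 1 / 2) {k : ℕ}
    (hk : k = ⌈Real.logb 2 (1 / ε)⌉₊) : 1 ≤ k ∧ coeff k 1 ≤ 1 / 2 + ε := by
  have hlog : Real.logb 2 (1 / ε) ≤ k := hk ▸ Nat.le_ceil _
  have hpow : 1 / ε ≤ 2 ^ k := by
    rw [Real.logb_le_iff_le_rpow (by norm_num) (by positivity)] at hlog
    exact_mod_cast hlog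
  have h1 : 1 ≤ ε * 2 ^ k := by
    rw [div_le_iff₀ hε] at hpow
    linarith
  have hk1 : 1 ≤ k := by
    by_contra h0
    obtain rfl : k = 0 := by omega
    norm_num at h1
    linarith
  refine ⟨hk1, ?_⟩
  rw [coeff, div_le_iff₀ (coeff_denom_pos hk1), Nat.sub_add_cancel hk1, pow_succ]
  -- After clearing the denominator the claim is `1/2 + 3ε ≤ 2ε·2^k`; it follows from `ε·2^k ≥ 1`
  -- and `ε ≤ 1/2`.
  nlinarith

end PathTSP

/-! ### The main theorem. -/

theorem mainTheorem2 {V : Type*} [Fintype V] [DecidableEq V] [MetricSpace V]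
    (s t : V) (hst : s ≠ t) (ε : ℝ) (hε : 0 < ε) (hε' : ε ≤ 1 / 2)
    (k : ℕ) (hk : k = ⌈Real.logb 2 (1 / ε)⌉₊) :
    (PathTSP.coeff k 1 = ((2 : ℝ) ^ k - 1) / ((2 : ℝ) ^ (k + 1) - 3) ∧
      PathTSP.coeff k 1 ≤ 1 / 2 + ε) ∧
    (∃ o : PathTSP.Output V, PathTSP.Returns k 1 (PathTSP.topInput s t) o) ∧
    ∃ OPT : ℝ,
      IsLeast {r : ℝ | ∃ H : Finset (Sym2 V), PathTSP.IsTour s t H ∧ r = PathTSP.setCost H} OPT ∧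
      ∀ o : PathTSP.Output V, PathTSP.Returns k 1 (PathTSP.topInput s t) o →
        PathTSP.IsTreeOn Finset.univ o.S ∧
        PathTSP.coeff k 1 • o.y ∈ PathTSP.tJoinPolyhedron (PathTSP.wrongParity o.S s t) ∧
        PathTSP.setCost o.S + PathTSP.coeff k 1 * PathTSP.vecCost o.y ≤ (3 / 2 + ε) * OPT := by
  obtain ⟨hk1, hle⟩ := PathTSP.coeff_one_le hε hε' hk
  have hc := PathTSP.coeff_pos hk1 1
  have hck := PathTSP.coeff_pos hk1 k
  have hone := PathTSP.coeff_one hk1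
  refine ⟨⟨by rw [PathTSP.coeff, Nat.sub_add_cancel hk1], hle⟩,
    PathTSP.topInput_valid.exists_returns (k - 1) 1 _ (by omega), ?_⟩
  obtain ⟨OPT, hOPT⟩ := PathTSP.exists_isLeast_tour hst
  refine ⟨OPT, hOPT, fun o ho => ?_⟩
  obtain ⟨hy, hS, hcut⟩ := ho.invariant hk1 PathTSP.topInput_valid
  rw [PathTSP.topInput_W] at hy hS
  change PathTSP.Fractional Finset.univ s t o.y at hy
  have hdiag : ∀ e ∈ o.S, ¬ e.IsDiag := fun e he => PathTSP.not_isDiag_of_mem_edgesIn (hS.1 he)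
  have hsep : ∀ U : Finset V, s ∈ U → t ∉ U → ¬ Odd #(o.S ∩ PathTSP.cut U) →
      1 ≤ PathTSP.coeff k 1 * PathTSP.weight o.y (PathTSP.cut U) := by
    intro U hs ht hodd
    refine hone.ge.trans (hcut U ?_ ?_ (Nat.not_odd_iff_even.1 hodd)).1
    · simpa [PathTSP.topInput] using hs
    · intro v hv
      simp only [PathTSP.topInput, Finset.empty_union, Finset.mem_sdiff, Finset.mem_univ,
        Finset.mem_singleton, true_and]
      exact fun h => ht (h ▸ hv)
  refine ⟨hS, ⟨fun e => mul_nonneg hc.le (hy.nonneg e), fun e he => ?_, fun U hU hU' hodd => ?_⟩, ?_⟩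
  · have := hy.support e fun h => PathTSP.not_isDiag_of_mem_edgesIn h he
    simp [this]
  · rw [PathTSP.odd_card_inter_wrongParity hdiag] at hodd
    rw [PathTSP.weight_smul]
    -- Sets not separating `s` from `t` have `y ≥ 2`, and `2λ_1 = 1 + λ_k ≥ 1`. For separating sets,
    -- oddness of `|U ∩ T|` means that the tree meets the cut evenly; passing to the complement puts
    -- `s` inside.
    by_cases hs : s ∈ U <;> by_cases ht : t ∈ U
    · have := hy.two_le_of_mem hs ht fun h => hU' (Finset.univ_subset_iff.1 h)
      nlinarith
    · exact hsep U hs ht (by tauto)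
    · rw [← PathTSP.cut_compl] at hodd ⊢
      exact hsep Uᶜ (by simpa) (by simpa) (by tauto)
    · have := hy.two_le U hs ht fun hd => hU.ne_empty <|
        (Finset.disjoint_self_iff_empty U).1 (hd.mono_right (Finset.subset_univ U))
      nlinarith
  · obtain ⟨H, hH, rfl⟩ := hOPT.1
    obtain ⟨h, b, hT, hsub⟩ := hH.exists_tourOn
    have h1 := ho.cost_le hk1 PathTSP.topInput_valid h 0 b hT
    rw [← hT.setCost_edges] at h1
    have h2 : PathTSP.setCost (PathTSP.tourEdges h 0 b) ≤ PathTSP.setCost H :=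
      Finset.sum_le_sum_of_subset_of_nonneg hsub fun e _ _ => PathTSP.edgeCost_nonneg e
    have h3 := PathTSP.setCost_nonneg H
    nlinarith
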